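/- Let $\mathbb K$ be a field of characteristic $0$. Let $X=\{1,2,3,4\}$ be the quandle in which $t\triangleright\cdot$ is the permutation $g_t$ with $g_1=(2\,3\,4)$, $g_2=(1\,4\,3)$, $g_3=(1\,2\,4)$, $g_4=(1\,3\,2)$ (cycle notation), let $V$ be the $\mathbb K$-vector space with basis $(e_t)_{t\in X}$ and braiding $c(e_s\otimes e_t)=-e_{s\triangleright t}\otimes e_s$, and let $\mathfrak B=\mathfrak B(4B)$ be its Nichols algebra, that is, $TV/I$, where $TV$ carries the braided comultiplication $\Delta$ for which the elements of $V$ are primitive and $I$ is the largest homogeneous two-sided ideal of $TV$ without nonzero homogeneous elements of degree $<2$ such that $\Delta(I)\subseteq I\otimes TV+TV\otimes I$. For $t\in X$ let $\partial_t:\mathfrak B\to\mathfrak B$ be the braided derivation, determined by $\Delta(v)\in v\otimes 1+\sum_{t\in X}\partial_t(v)\otimes e_t+\mathfrak B\otimes\bigoplus_{j\ge 2}\mathfrak B(j)$, and let the shift $\phi_t$ be the linear automorphism of $\mathfrak B$ with $\phi_t(v_0+v_1e_t)=v_1+v_0e_t$ for all $v_0,v_1\in\ker\partial_t$ (every element of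 $\mathfrak B$ is uniquely of the form $v_0+v_1e_t$). The shift group $\Phi$ is the group generated by $\phi_1,\dots,\phi_4$. Then $\dim\mathfrak B=72$, and $\Phi$ is infinite. Specifically, over every extension field of $\mathbb K$ that contains a primitive third root of unity $\rho$, the endomorphism $\phi_1\phi_2$ (after extension of scalars) has a Jordan normal form consisting of $24$ blocks of size $3$, namely eight for each of the eigenvalues $1$, $\rho$ and $\rho^2$. Consequently $\phi_1\phi_2$ has infinite order, and $\langle\phi_1,\phi_2\rangle\cong C_2*C_2$. -/

import Mathlib

open scoped TensorProduct Quandles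

/-! # Nichols algebras over a quandle with a constant cocycle -/

namespace RackNichols

section TensorAlgebra

variable {K : Type*} [Field K] {X : Type*} [Quandle X]

/-- The action of `g_s` on the tensor algebra `TV` of `V = K X` (the free algebra on the
basis `(e_t)`): the algebra endomorphism with `g_s (e_t) = q e_{s ▷ t}`. -/
noncomputable def act (q : K) (s : X) : FreeAlgebra K X →ₐ[K] FreeAlgebra K X :=
  FreeAlgebra.lift K fun t => q • FreeAlgebra.ι K (s ◃ t)

/-- The operator `a ⊗ b ↦ g_s(a) ⊗ e_s b` on `TV ⊗ TV`. -/
noncomputable def braidGen (q : K) (s : X) :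
    Module.End K (FreeAlgebra K X ⊗[K] FreeAlgebra K X) :=
  TensorProduct.map (act q s).toLinearMap (LinearMap.mulLeft K (FreeAlgebra.ι K s))

/-- For a word `v` in the generators, the operator `a ⊗ b ↦ g_v(a) ⊗ v b` on `TV ⊗ TV`,
extended linearly in `v`. -/
noncomputable def braidAct (q : K) :
    FreeAlgebra K X →ₐ[K] Module.End K (FreeAlgebra K X ⊗[K] FreeAlgebra K X) :=
  FreeAlgebra.lift K (braidGen q)

/-- The braiding `c (v ⊗ w) = g_v(w) ⊗ v` of `TV`, extending the braiding
`c (e_s ⊗ e_t) = q e_{s ▷ t} ⊗ e_s` of `V`. -/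
noncomputable def braiding (q : K) :
    FreeAlgebra K X ⊗[K] FreeAlgebra K X →ₗ[K] FreeAlgebra K X ⊗[K] FreeAlgebra K X :=
  TensorProduct.lift
    ((LinearMap.lcomp K _ ((TensorProduct.mk K (FreeAlgebra K X) (FreeAlgebra K X)).flip 1)).comp
      (braidAct q).toLinearMap)

/-- The multiplication `(μ ⊗ μ) (id ⊗ c ⊗ id)` of the braided tensor square of `TV`. -/
noncomputable def braidedMul (q : K) :
    (FreeAlgebra K X ⊗[K] FreeAlgebra K X) ⊗[K] (FreeAlgebra K X ⊗[K] FreeAlgebra K X) →ₗ[K]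
      FreeAlgebra K X ⊗[K] FreeAlgebra K X :=
  let T := FreeAlgebra K X
  TensorProduct.map (LinearMap.mul' K T) (LinearMap.mul' K T) ∘ₗ
    (TensorProduct.assoc K T T (T ⊗[K] T)).symm.toLinearMap ∘ₗ
    LinearMap.lTensor T (TensorProduct.assoc K T T T).toLinearMap ∘ₗ
    LinearMap.lTensor T (LinearMap.rTensor T (braiding q)) ∘ₗ
    LinearMap.lTensor T (TensorProduct.assoc K T T T).symm.toLinearMap ∘ₗ
    (TensorProduct.assoc K T T (T ⊗[K] T)).toLinearMap

/-- Left multiplication by `e_s ⊗ 1 + 1 ⊗ e_s` in the braided tensor square of `TV`. -/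
noncomputable def comulGen (q : K) (s : X) :
    Module.End K (FreeAlgebra K X ⊗[K] FreeAlgebra K X) :=
  LinearMap.rTensor _ (LinearMap.mulLeft K (FreeAlgebra.ι K s)) + braidGen q s

/-- The braided comultiplication `Δ` of `TV`. It is the unique linear map with `Δ 1 = 1 ⊗ 1`,
with `e_t` primitive, and multiplicative into the braided tensor square:
see `comul_one`, `comul_ι`, `comul_mul`. -/
noncomputable def comul (q : K) :
    FreeAlgebra K X →ₗ[K] FreeAlgebra K X ⊗[K] FreeAlgebra K X :=
  (LinearMap.applyₗ ((1 : FreeAlgebra K X) ⊗ₜ[K] (1 : FreeAlgebra K X))).comp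
    (FreeAlgebra.lift K (comulGen q) : FreeAlgebra K X →ₐ[K] _).toLinearMap

theorem act_ι (q : K) (s t : X) :
    act q s (FreeAlgebra.ι K t) = q • FreeAlgebra.ι K (s ◃ t) := by
  simp [act]

theorem comul_one (q : K) : comul q (1 : FreeAlgebra K X) = 1 ⊗ₜ 1 := by
  simp [comul]

theorem comul_ι_mul (q : K) (s : X) (v : FreeAlgebra K X) :
    comul q (FreeAlgebra.ι K s * v) = comulGen q s (comul q v) := by
  simp [comul]

theorem comul_ι (q : K) (s : X) :
    comul q (FreeAlgebra.ι K s) = FreeAlgebra.ι K s ⊗ₜ 1 + 1 ⊗ₜ FreeAlgebra.ι K s := by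
  have := comul_ι_mul q s 1
  rw [mul_one, comul_one] at this
  simp [this, comulGen, braidGen]

theorem braidAct_ι (q : K) (s : X) :
    braidAct q (FreeAlgebra.ι K s) = braidGen q s := by
  simp [braidAct]

theorem braidAct_tmul_mul (q : K) (v a b d : FreeAlgebra K X) :
    braidAct q v (a ⊗ₜ (b * d)) = LinearMap.lTensor _ (LinearMap.mulRight K d)
      (braidAct q v (a ⊗ₜ b)) := by
  suffices h : ∀ z, braidAct q v (LinearMap.lTensor _ (LinearMap.mulRight K d) z) =
      LinearMap.lTensor _ (LinearMap.mulRight K d) (braidAct q v z) by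
    simpa using h (a ⊗ₜ b)
  induction v using FreeAlgebra.induction with
  | grade0 r => intro z; simp [Algebra.algebraMap_eq_smul_one]
  | grade1 s =>
    intro z
    rw [braidAct_ι]
    induction z with
    | zero => simp
    | tmul a b => simp [braidGen, mul_assoc]
    | add x y hx hy => simp only [map_add, hx, hy]
  | mul x y hx hy => intro z; simp [hx, hy]
  | add x y hx hy => intro z; simp [hx, hy]

theorem braidedMul_tmul (q : K) (a b : FreeAlgebra K X)
    (z : FreeAlgebra K X ⊗[K] FreeAlgebra K X) :
    braidedMul q ((a ⊗ₜ b) ⊗ₜ z) =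
      LinearMap.rTensor _ (LinearMap.mulLeft K a) (braidAct q b z) := by
  induction z with
  | zero => simp
  | add x y hx hy => simp only [TensorProduct.tmul_add, map_add, hx, hy]
  | tmul c d =>
    have h1 : braidAct q b (c ⊗ₜ d) = LinearMap.lTensor _ (LinearMap.mulRight K d)
        (braidAct q b (c ⊗ₜ 1)) := by
      simpa using braidAct_tmul_mul q b c 1 d
    rw [h1]
    have h2 : braiding q (b ⊗ₜ c) = braidAct q b (c ⊗ₜ 1) := by
      simp [braiding]
    simp only [braidedMul, LinearMap.comp_apply, LinearEquiv.coe_coe, TensorProduct.assoc_tmul,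
      LinearMap.lTensor_tmul, TensorProduct.assoc_symm_tmul, LinearMap.rTensor_tmul, h2]
    generalize braidAct q b (c ⊗ₜ 1) = y
    induction y with
    | zero => simp
    | tmul u w => simp
    | add x y hx hy => simp only [TensorProduct.add_tmul, TensorProduct.tmul_add, map_add, hx, hy]

/-- `Δ` is multiplicative into the braided tensor square of `TV`. -/
theorem comul_mul (q : K) (v w : FreeAlgebra K X) :
    comul q (v * w) = braidedMul q (comul q v ⊗ₜ comul q w) := by
  have key : ∀ (s : X) (z y : FreeAlgebra K X ⊗[K] FreeAlgebra K X),
      comulGen q s (braidedMul q (z ⊗ₜ y)) = braidedMul q ((comulGen q s z) ⊗ₜ y) := by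
    intro s z y
    induction z with
    | zero => simp
    | add x y hx hy => simp only [TensorProduct.add_tmul, map_add, hx, hy]
    | tmul a b =>
      have : comulGen q s (a ⊗ₜ[K] b) = (FreeAlgebra.ι K s * a) ⊗ₜ b
          + (act q s a) ⊗ₜ (FreeAlgebra.ι K s * b) := by
        simp [comulGen, braidGen]
      rw [this, TensorProduct.add_tmul, map_add, braidedMul_tmul, braidedMul_tmul,
        braidedMul_tmul, map_mul, braidAct_ι, Module.End.mul_apply]
      generalize braidAct q b y = u
      induction u with
      | zero => simp
      | add x y hx hy =>
        simp only [map_add, hx, hy]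
        abel
      | tmul c d => simp [comulGen, braidGen]
  suffices h : ∀ y, (FreeAlgebra.lift K (comulGen q) : FreeAlgebra K X →ₐ[K] _) v y =
      braidedMul q (comul q v ⊗ₜ y) by
    simpa [comul] using h (comul q w)
  have base : ∀ y : FreeAlgebra K X ⊗[K] FreeAlgebra K X,
      braidedMul q (((1 : FreeAlgebra K X) ⊗ₜ (1 : FreeAlgebra K X)) ⊗ₜ y) = y := by
    intro y
    rw [braidedMul_tmul]
    simp
  have gen : ∀ z y : FreeAlgebra K X ⊗[K] FreeAlgebra K X,
      (FreeAlgebra.lift K (comulGen q) : FreeAlgebra K X →ₐ[K] _) v (braidedMul q (z ⊗ₜ y)) =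
      braidedMul q
        ((FreeAlgebra.lift K (comulGen q) : FreeAlgebra K X →ₐ[K] _) v z ⊗ₜ y) := by
    induction v using FreeAlgebra.induction with
    | grade0 r => intro z y; simp [Algebra.algebraMap_eq_smul_one, ← TensorProduct.smul_tmul']
    | grade1 s => intro z y; simpa using key s z y
    | mul a b ha hb => intro z y; simp [ha, hb]
    | add a b ha hb => intro z y; simp [ha, hb, TensorProduct.add_tmul]
  intro y
  have := gen ((1 : FreeAlgebra K X) ⊗ₜ (1 : FreeAlgebra K X)) y
  rw [base] at this
  simpa [comul] using this

variable (K X) in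
/-- The homogeneous component `TV(n) = V^n` of degree `n` of `TV`. -/
noncomputable def degreePart (n : ℕ) : Submodule K (FreeAlgebra K X) :=
  Submodule.span K (Set.range (FreeAlgebra.ι K : X → FreeAlgebra K X)) ^ n

/-- The two-sided ideals `J` of `TV` that are homogeneous, satisfy
`Δ(J) ⊆ J ⊗ TV + TV ⊗ J`, and have no nonzero homogeneous elements of degree `< 2`. -/
structure IsNicholsIdeal (q : K) (J : Ideal (FreeAlgebra K X)) : Prop where
  isTwoSided : J.IsTwoSided
  homogeneous : J.restrictScalars K ≤ ⨆ n, J.restrictScalars K ⊓ degreePart K X n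
  degree : ∀ n < 2, ∀ x ∈ J, x ∈ degreePart K X n → x = 0
  coideal : ∀ x ∈ J, comul q x ∈
    LinearMap.range (LinearMap.rTensor (FreeAlgebra K X) (J.restrictScalars K).subtype) ⊔
    LinearMap.range (LinearMap.lTensor (FreeAlgebra K X) (J.restrictScalars K).subtype)

/-- The maximal such ideal: see `isGreatest_nicholsIdeal`. -/
noncomputable def nicholsIdeal (q : K) : Ideal (FreeAlgebra K X) :=
  sSup {J | IsNicholsIdeal q J}

theorem nicholsIdeal_induction {q : K} {p : FreeAlgebra K X → Prop}
    (mem : ∀ J, IsNicholsIdeal q J → ∀ x ∈ J, p x) (zero : p 0)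
    (add : ∀ x y, p x → p y → p (x + y)) {x : FreeAlgebra K X} (hx : x ∈ nicholsIdeal q) :
    p x := by
  rw [nicholsIdeal, sSup_eq_iSup'] at hx
  exact Submodule.iSup_induction _ (motive := p) hx (fun J x hx => mem J.1 J.2 x hx) zero add

theorem IsNicholsIdeal.le {q : K} {J : Ideal (FreeAlgebra K X)} (hJ : IsNicholsIdeal q J) :
    J ≤ nicholsIdeal q :=
  le_sSup hJ

instance nicholsIdeal_isTwoSided (q : K) :
    (nicholsIdeal q : Ideal (FreeAlgebra K X)).IsTwoSided := by
  refine ⟨fun {a} b ha => ?_⟩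
  refine nicholsIdeal_induction (p := fun a => a * b ∈ nicholsIdeal q) ?_ ?_ ?_ ha
  · intro J hJ x hx
    have := hJ.isTwoSided
    exact hJ.le (J.mul_mem_right b hx)
  · simp
  · intro x y hx hy
    rw [add_mul]
    exact add_mem hx hy

/-- The coefficient of `e_t` of an element of `TV`. -/
noncomputable def coeff [DecidableEq X] (t : X) : FreeAlgebra K X →ₗ[K] K :=
  (TrivSqZeroExt.sndHom K K).comp
    (FreeAlgebra.lift K (fun s => TrivSqZeroExt.inr (if s = t then (1 : K) else 0)) :
      FreeAlgebra K X →ₐ[K] TrivSqZeroExt K K).toLinearMap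

section Coefficients

set_option linter.unusedSectionVars false

variable [DecidableEq X]

theorem coeff_ι (t s : X) :
    coeff t (FreeAlgebra.ι K s) = if s = t then (1 : K) else 0 := by
  simp only [coeff, LinearMap.comp_apply, AlgHom.toLinearMap_apply, FreeAlgebra.lift_ι_apply,
    TrivSqZeroExt.sndHom_apply, TrivSqZeroExt.snd_inr]

theorem coeff_one (t : X) : coeff t (1 : FreeAlgebra K X) = 0 := by
  simp [coeff]

theorem fst_lift (t : X) (v : FreeAlgebra K X) :
    ((FreeAlgebra.lift K (fun s => TrivSqZeroExt.inr (if s = t then (1 : K) else 0)) :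
      FreeAlgebra K X →ₐ[K] TrivSqZeroExt K K) v).fst = FreeAlgebra.algebraMapInv v := by
  have : ((TrivSqZeroExt.fstHom K K K).comp
      (FreeAlgebra.lift K (fun s => TrivSqZeroExt.inr (if s = t then (1 : K) else 0)) :
      FreeAlgebra K X →ₐ[K] TrivSqZeroExt K K)) = FreeAlgebra.algebraMapInv := by
    ext s
    simp only [FreeAlgebra.algebraMapInv, Function.comp_apply, AlgHom.comp_apply,
      FreeAlgebra.lift_ι_apply, TrivSqZeroExt.fstHom_apply, TrivSqZeroExt.fst_inr, Pi.zero_apply]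
  exact DFunLike.congr_fun this v

theorem coeff_mul (t : X) (v w : FreeAlgebra K X) :
    coeff t (v * w) = FreeAlgebra.algebraMapInv v * coeff t w
      + FreeAlgebra.algebraMapInv w * coeff t v := by
  rw [← fst_lift t v, ← fst_lift t w]
  simp only [coeff, LinearMap.comp_apply, AlgHom.toLinearMap_apply, map_mul,
    TrivSqZeroExt.sndHom_apply, TrivSqZeroExt.snd_mul, smul_eq_mul, MulOpposite.smul_eq_mul_unop,
    MulOpposite.unop_op]
  ring

theorem algebraMapInv_ι (t : X) :
    FreeAlgebra.algebraMapInv (FreeAlgebra.ι K t) = (0 : K) := by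
  simp [FreeAlgebra.algebraMapInv]

theorem algebraMapInv_span {v : FreeAlgebra K X}
    (hv : v ∈ Submodule.span K (Set.range (FreeAlgebra.ι K : X → FreeAlgebra K X))) :
    FreeAlgebra.algebraMapInv v = (0 : K) := by
  induction hv using Submodule.span_induction with
  | mem x h => obtain ⟨s, rfl⟩ := h; exact algebraMapInv_ι s
  | zero => simp
  | add x y _ _ hx hy => simp [hx, hy]
  | smul a x _ hx => simp [hx]

theorem algebraMapInv_degreePart {n : ℕ} {v : FreeAlgebra K X}
    (hv : v ∈ degreePart K X (n + 1)) : FreeAlgebra.algebraMapInv v = (0 : K) := by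
  rw [degreePart, pow_succ] at hv
  induction hv using Submodule.mul_induction_on' with
  | mem_mul_mem a _ b hb => rw [map_mul, algebraMapInv_span hb, mul_zero]
  | add x _ y _ hx hy => rw [map_add, hx, hy, add_zero]

theorem coeff_degreePart (t : X) {n : ℕ} {v : FreeAlgebra K X}
    (hv : v ∈ degreePart K X (n + 2)) : coeff t v = (0 : K) := by
  rw [degreePart, pow_succ] at hv
  induction hv using Submodule.mul_induction_on' with
  | mem_mul_mem a ha b hb =>
    rw [coeff_mul, algebraMapInv_span hb, algebraMapInv_degreePart (n := n) ha, zero_mul,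
      zero_mul, add_zero]
  | add x _ y _ hx hy => rw [map_add, hx, hy, add_zero]

theorem IsNicholsIdeal.induction {q : K} {J : Ideal (FreeAlgebra K X)} (hJ : IsNicholsIdeal q J)
    {p : FreeAlgebra K X → Prop} (mem : ∀ n x, x ∈ degreePart K X (n + 2) → x ∈ J → p x)
    (zero : p 0) (add : ∀ x y, p x → p y → p (x + y)) {x : FreeAlgebra K X} (hx : x ∈ J) :
    p x := by
  refine Submodule.iSup_induction _ (motive := p) (hJ.homogeneous hx) ?_ zero add
  rintro n y ⟨hyJ, hyn⟩
  match n, hyn with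
  | 0, hyn => rw [hJ.degree 0 (by omega) y hyJ hyn]; exact zero
  | 1, hyn => rw [hJ.degree 1 (by omega) y hyJ hyn]; exact zero
  | n + 2, hyn => exact mem n y hyn hyJ

theorem algebraMapInv_nicholsIdeal {q : K} {v : FreeAlgebra K X} (hv : v ∈ nicholsIdeal q) :
    FreeAlgebra.algebraMapInv v = (0 : K) := by
  refine nicholsIdeal_induction (p := fun v => FreeAlgebra.algebraMapInv v = (0 : K)) ?_ ?_ ?_ hv
  · intro J hJ x hx
    refine hJ.induction (p := fun v => FreeAlgebra.algebraMapInv v = (0 : K)) ?_ ?_ ?_ hx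
    · intro n x hx _; exact algebraMapInv_degreePart hx
    · simp
    · intro x y hx hy; rw [map_add, hx, hy, add_zero]
  · simp
  · intro x y hx hy; rw [map_add, hx, hy, add_zero]

theorem coeff_nicholsIdeal (t : X) {q : K} {v : FreeAlgebra K X} (hv : v ∈ nicholsIdeal q) :
    coeff t v = (0 : K) := by
  refine nicholsIdeal_induction (p := fun v => coeff t v = (0 : K)) ?_ ?_ ?_ hv
  · intro J hJ x hx
    refine hJ.induction (p := fun v => coeff t v = (0 : K)) ?_ ?_ ?_ hx
    · intro n x hx _; exact coeff_degreePart t hx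
    · simp
    · intro x y hx hy; rw [map_add, hx, hy, add_zero]
  · simp
  · intro x y hx hy; rw [map_add, hx, hy, add_zero]

end Coefficients

theorem comul_nicholsIdeal {q : K} {v : FreeAlgebra K X} (hv : v ∈ nicholsIdeal q) :
    comul q v ∈
    LinearMap.range (LinearMap.rTensor (FreeAlgebra K X)
      ((nicholsIdeal q).restrictScalars K).subtype) ⊔
    LinearMap.range (LinearMap.lTensor (FreeAlgebra K X)
      ((nicholsIdeal q).restrictScalars K).subtype) := by
  refine nicholsIdeal_induction (p := fun v => comul q v ∈ _) ?_ ?_ ?_ hv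
  · intro J hJ x hx
    have hle : J.restrictScalars K ≤ (nicholsIdeal q).restrictScalars K := hJ.le
    have hsub : (J.restrictScalars K).subtype =
        ((nicholsIdeal q).restrictScalars K).subtype ∘ₗ Submodule.inclusion hle := rfl
    have h := hJ.coideal x hx
    rw [hsub, LinearMap.rTensor_comp, LinearMap.lTensor_comp] at h
    have h1 := LinearMap.range_comp_le_range
      (LinearMap.rTensor (FreeAlgebra K X) (Submodule.inclusion hle))
      (LinearMap.rTensor (FreeAlgebra K X) ((nicholsIdeal q).restrictScalars K).subtype)
    have h2 := LinearMap.range_comp_le_range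
      (LinearMap.lTensor (FreeAlgebra K X) (Submodule.inclusion hle))
      (LinearMap.lTensor (FreeAlgebra K X) ((nicholsIdeal q).restrictScalars K).subtype)
    exact (sup_le_sup h1 h2) h
  · simp
  · intro x y hx hy
    rw [map_add]
    exact add_mem hx hy

/-- `nicholsIdeal q` is the unique maximal ideal satisfying `IsNicholsIdeal q`. -/
theorem isGreatest_nicholsIdeal (q : K) :
    IsGreatest {J : Ideal (FreeAlgebra K X) | IsNicholsIdeal q J} (nicholsIdeal q) := by
  classical
  refine ⟨⟨inferInstance, ?_, ?_, fun x hx => comul_nicholsIdeal hx⟩, fun J hJ => hJ.le⟩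
  · intro x hx
    refine nicholsIdeal_induction (p := fun x => x ∈
      ⨆ n, (nicholsIdeal q).restrictScalars K ⊓ degreePart K X n) ?_ ?_ ?_ hx
    · intro J hJ x hx
      have hle : J.restrictScalars K ≤ (nicholsIdeal q).restrictScalars K := hJ.le
      exact iSup_mono (fun n => inf_le_inf_right _ hle) (hJ.homogeneous hx)
    · exact zero_mem _
    · intro x y hx hy; exact add_mem hx hy
  · intro n hn x hxI hx
    match n, hn with
    | 0, _ =>
      rw [degreePart, pow_zero] at hx
      obtain ⟨c, rfl⟩ := Submodule.mem_one.mp hx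
      have := algebraMapInv_nicholsIdeal hxI
      rw [FreeAlgebra.algebraMap_leftInverse c] at this
      simp [this]
    | 1, _ =>
      rw [degreePart, pow_one, Finsupp.mem_span_range_iff_exists_finsupp] at hx
      obtain ⟨c, rfl⟩ := hx
      have : c = 0 := by
        ext t
        have := coeff_nicholsIdeal t hxI
        simpa [Finsupp.sum, coeff_ι] using this
      simp [this]

end TensorAlgebra

section Quotient

variable {K : Type*} [Field K] {X : Type*} [Quandle X]

variable (X) in
/-- The Nichols algebra `TV / I` of the quandle `X` with the constant cocycle `q`. -/
def NicholsAlgebra (q : K) : Type _ :=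
  FreeAlgebra K X ⧸ (nicholsIdeal q : Ideal (FreeAlgebra K X))

noncomputable instance (q : K) : Ring (NicholsAlgebra X q) :=
  inferInstanceAs (Ring (FreeAlgebra K X ⧸ (nicholsIdeal q : Ideal (FreeAlgebra K X))))

noncomputable instance (q : K) : Algebra K (NicholsAlgebra X q) :=
  inferInstanceAs (Algebra K (FreeAlgebra K X ⧸ (nicholsIdeal q : Ideal (FreeAlgebra K X))))

/-- The projection of `TV` onto the Nichols algebra. -/
noncomputable def proj (q : K) : FreeAlgebra K X →ₐ[K] NicholsAlgebra X q :=
  Ideal.Quotient.mkₐ K (nicholsIdeal q)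

/-- The generators `e_t` of the Nichols algebra. -/
noncomputable def e (q : K) (t : X) : NicholsAlgebra X q := proj q (FreeAlgebra.ι K t)

theorem proj_surjective (q : K) : Function.Surjective (proj (X := X) q) :=
  Ideal.Quotient.mkₐ_surjective K _

theorem proj_eq_zero {q : K} {v : FreeAlgebra K X} : proj q v = 0 ↔ v ∈ nicholsIdeal q :=
  Ideal.Quotient.eq_zero_iff_mem

/-- A linear map on `TV` that vanishes on the ideal `I`, as a map on the Nichols algebra. -/
noncomputable def descend {q : K} {M : Type*} [AddCommGroup M] [Module K M]
    (f : FreeAlgebra K X →ₗ[K] M) (hf : ∀ v ∈ nicholsIdeal q, f v = 0) :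
    NicholsAlgebra X q →ₗ[K] M :=
  (((nicholsIdeal q).restrictScalars K).liftQ f hf).comp
    (Submodule.Quotient.restrictScalarsEquiv K (nicholsIdeal q)).symm.toLinearMap

theorem descend_proj {q : K} {M : Type*} [AddCommGroup M] [Module K M]
    (f : FreeAlgebra K X →ₗ[K] M) (hf : ∀ v ∈ nicholsIdeal q, f v = 0) (v : FreeAlgebra K X) :
    descend f hf (proj q v) = f v := rfl

theorem map_proj_comul {q : K} {v : FreeAlgebra K X} (hv : v ∈ nicholsIdeal q) :
    TensorProduct.map (proj q).toLinearMap (proj q).toLinearMap (comul q v) = 0 := by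
  have h0 : (proj q).toLinearMap ∘ₗ ((nicholsIdeal (X := X) q).restrictScalars K).subtype = 0 := by
    ext x
    exact proj_eq_zero.mpr x.2
  have : LinearMap.range (LinearMap.rTensor (FreeAlgebra K X)
      ((nicholsIdeal q).restrictScalars K).subtype) ⊔
      LinearMap.range (LinearMap.lTensor (FreeAlgebra K X)
      ((nicholsIdeal q).restrictScalars K).subtype) ≤
      LinearMap.ker (TensorProduct.map (proj (X := X) q).toLinearMap (proj q).toLinearMap) := by
    refine sup_le ?_ ?_
    · rw [LinearMap.range_le_ker_iff, LinearMap.rTensor, ← TensorProduct.map_comp, h0,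
        TensorProduct.map_zero_left]
    · rw [LinearMap.range_le_ker_iff, LinearMap.lTensor, ← TensorProduct.map_comp, h0,
        TensorProduct.map_zero_right]
  exact this (comul_nicholsIdeal hv)

/-- The comultiplication of the Nichols algebra, induced by that of `TV`. -/
noncomputable def comulB (q : K) :
    NicholsAlgebra X q →ₗ[K] NicholsAlgebra X q ⊗[K] NicholsAlgebra X q :=
  descend (TensorProduct.map (proj q).toLinearMap (proj q).toLinearMap ∘ₗ comul q)
    fun _ hv => map_proj_comul hv

/-- The coefficient of `e_t` of (the component of degree one of) an element of the
Nichols algebra. -/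
noncomputable def coeffB [DecidableEq X] (q : K) (t : X) : NicholsAlgebra X q →ₗ[K] K :=
  descend (coeff t) fun _ hv => coeff_nicholsIdeal t hv

/-- The braided derivation `∂_t`: it is given by
`Δ(v) = v ⊗ 1 + ∑ t, ∂_t(v) ⊗ e_t + (terms whose second factor has degree at least two)`,
so `∂_t(v)` is obtained by taking the coefficient of `e_t` in the second factor of `Δ(v)`. -/
noncomputable def der [DecidableEq X] (q : K) (t : X) :
    NicholsAlgebra X q →ₗ[K] NicholsAlgebra X q :=
  (TensorProduct.rid K _).toLinearMap ∘ₗ LinearMap.lTensor _ (coeffB q t) ∘ₗ comulB q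

/-- The defining property of the shift `φ_t`, with `m` the order of the cocycle:
`∑_{j<m} v_j e_t^j ↦ v_{m-1} + ∑_{1≤j<m} v_{j-1} e_t^j` for all `v_0, …, v_{m-1} ∈ ker ∂_t`. -/
def IsShift [DecidableEq X] (q : K) (t : X)
    (φ : NicholsAlgebra X q ≃ₗ[K] NicholsAlgebra X q) : Prop :=
  ∀ v : ℕ → NicholsAlgebra X q, (∀ j < orderOf q, der q t (v j) = 0) →
    φ (∑ j ∈ Finset.range (orderOf q), v j * e q t ^ j) =
      v (orderOf q - 1) + ∑ j ∈ Finset.Ico 1 (orderOf q), v (j - 1) * e q t ^ j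

section Derivations

variable [DecidableEq X]

/-- The lift of `∂_t` to `TV`. -/
noncomputable def derT (q : K) (t : X) : FreeAlgebra K X →ₗ[K] FreeAlgebra K X :=
  (TensorProduct.rid K _).toLinearMap ∘ₗ LinearMap.lTensor _ (coeff t) ∘ₗ comul q

theorem der_proj (q : K) (t : X) (v : FreeAlgebra K X) :
    der q t (proj q v) = proj q (derT q t v) := by
  simp only [der, derT, LinearMap.comp_apply, comulB, descend_proj]
  generalize comul q v = z
  induction z with
  | zero => simp
  | tmul a b => simp [coeffB, descend_proj]
  | add x y hx hy => simp only [map_add, hx, hy]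

theorem rid_algebraMapInv_comul (q : K) (v : FreeAlgebra K X) :
    TensorProduct.rid K _ (LinearMap.lTensor _
      (FreeAlgebra.algebraMapInv : FreeAlgebra K X →ₐ[K] K).toLinearMap (comul q v)) = v := by
  have key : ∀ (s : X) (z : FreeAlgebra K X ⊗[K] FreeAlgebra K X),
      TensorProduct.rid K _ (LinearMap.lTensor _
        (FreeAlgebra.algebraMapInv : FreeAlgebra K X →ₐ[K] K).toLinearMap (comulGen q s z)) =
      FreeAlgebra.ι K s * TensorProduct.rid K _ (LinearMap.lTensor _
        (FreeAlgebra.algebraMapInv : FreeAlgebra K X →ₐ[K] K).toLinearMap z) := by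
    intro s z
    induction z with
    | zero => simp
    | tmul a b => simp [comulGen, braidGen, algebraMapInv_ι]
    | add x y hx hy => simp only [map_add, hx, hy, mul_add]
  have gen : ∀ z : FreeAlgebra K X ⊗[K] FreeAlgebra K X,
      TensorProduct.rid K _ (LinearMap.lTensor _
        (FreeAlgebra.algebraMapInv : FreeAlgebra K X →ₐ[K] K).toLinearMap
        ((FreeAlgebra.lift K (comulGen q) : FreeAlgebra K X →ₐ[K] _) v z)) =
      v * TensorProduct.rid K _ (LinearMap.lTensor _
        (FreeAlgebra.algebraMapInv : FreeAlgebra K X →ₐ[K] K).toLinearMap z) := by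
    induction v using FreeAlgebra.induction with
    | grade0 r => intro z; simp [Algebra.algebraMap_eq_smul_one]
    | grade1 s => intro z; simpa using key s z
    | mul a b ha hb => intro z; simp only [map_mul, Module.End.mul_apply, ha, hb, mul_assoc]
    | add a b ha hb => intro z; simp only [map_add, LinearMap.add_apply, ha, hb, add_mul]
  simpa [comul] using gen (1 ⊗ₜ 1)

theorem derT_one (q : K) (t : X) : derT q t (1 : FreeAlgebra K X) = 0 := by
  simp [derT, comul_one, coeff_one]

theorem derT_ι_mul (q : K) (t s : X) (v : FreeAlgebra K X) :
    derT q t (FreeAlgebra.ι K s * v) =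
      FreeAlgebra.ι K s * derT q t v + (if s = t then act q t v else 0) := by
  have key : ∀ z : FreeAlgebra K X ⊗[K] FreeAlgebra K X,
      TensorProduct.rid K _ (LinearMap.lTensor _ (coeff t) (comulGen q s z)) =
      FreeAlgebra.ι K s * TensorProduct.rid K _ (LinearMap.lTensor _ (coeff t) z) +
      (if s = t then act q t (TensorProduct.rid K _ (LinearMap.lTensor _
        (FreeAlgebra.algebraMapInv : FreeAlgebra K X →ₐ[K] K).toLinearMap z)) else 0) := by
    intro z
    induction z with
    | zero => simp
    | tmul a b =>
      by_cases h : s = t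
      · subst h
        simp [comulGen, braidGen, coeff_mul, coeff_ι, algebraMapInv_ι]
      · simp [comulGen, braidGen, coeff_mul, coeff_ι, algebraMapInv_ι, h]
    | add x y hx hy =>
      simp only [map_add, hx, hy, mul_add]
      split_ifs
      · abel
      · simp
  have := key (comul q v)
  rw [rid_algebraMapInv_comul, ← comul_ι_mul] at this
  exact this

/-- `∂_t (v w) = v ∂_t(w) + ∂_t(v) g_t(w)`. -/
theorem derT_mul (q : K) (t : X) (v w : FreeAlgebra K X) :
    derT q t (v * w) = v * derT q t w + derT q t v * act q t w := by
  induction v using FreeAlgebra.induction generalizing w with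
  | grade0 r => simp [Algebra.algebraMap_eq_smul_one, derT_one]
  | grade1 s =>
    have h := derT_ι_mul q t s 1
    rw [mul_one, derT_one, mul_zero, zero_add, map_one] at h
    rw [derT_ι_mul, h]
    split_ifs <;> simp
  | mul a b ha hb =>
    rw [mul_assoc, ha, hb, ha, map_mul]
    simp only [mul_add, add_mul, mul_assoc, add_assoc]
  | add a b ha hb =>
    rw [add_mul, map_add, ha, hb, map_add]
    simp only [add_mul]
    abel

theorem derT_ι (q : K) (t s : X) :
    derT q t (FreeAlgebra.ι K s) = if s = t then 1 else 0 := by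
  have h := derT_ι_mul q t s 1
  rwa [mul_one, derT_one, mul_zero, zero_add, map_one] at h

theorem derT_act (q : K) (t : X) (v : FreeAlgebra K X) :
    derT q t (act q t v) = q • act q t (derT q t v) := by
  induction v using FreeAlgebra.induction with
  | grade0 r => simp [Algebra.algebraMap_eq_smul_one, derT_one]
  | grade1 s =>
    have : t ◃ s = t ↔ s = t := by
      conv_lhs => rhs; rw [← Quandle.fix (x := t)]
      exact Rack.left_cancel t
    rw [act_ι, map_smul, derT_ι, derT_ι]
    by_cases h : s = t <;> simp [this, h]
  | mul a b ha hb =>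
    simp only [map_mul, derT_mul, ha, hb, map_add, smul_add, mul_smul_comm, smul_mul_assoc]
  | add a b ha hb => simp only [map_add, ha, hb, smul_add]

theorem derT_derT (t : X) (v : FreeAlgebra K X) : derT (-1) t (derT (-1) t v) = 0 := by
  induction v using FreeAlgebra.induction with
  | grade0 r => simp [Algebra.algebraMap_eq_smul_one, derT_one]
  | grade1 s =>
    rw [derT_ι]
    split_ifs <;> simp [derT_one]
  | mul a b ha hb => simp [derT_mul, ha, hb, derT_act]
  | add a b ha hb => simp [ha, hb]

theorem der_der (t : X) (v : NicholsAlgebra X (-1 : K)) : der (-1) t (der (-1) t v) = 0 := by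
  obtain ⟨v, rfl⟩ := proj_surjective _ v
  rw [der_proj, der_proj, derT_derT, map_zero]

theorem der_mul_e (t : X) {v : NicholsAlgebra X (-1 : K)} (hv : der (-1) t v = 0) :
    der (-1) t (v * e (-1) t) = v := by
  obtain ⟨w, rfl⟩ := proj_surjective _ v
  rw [der_proj] at hv
  rw [e, ← map_mul, der_proj, derT_mul, derT_ι, map_add, map_mul, map_mul, hv]
  simp

/-- In the case of the constant cocycle `-1 ≠ 1`, of order two, the shifts are well-defined. -/
theorem existsUnique_isShift [NeZero (2 : K)] (t : X) : ∃! φ, IsShift (-1 : K) t φ := by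
  have hord : orderOf (-1 : K) = 2 := by
    rw [orderOf_neg_one, if_neg]
    intro h
    have : ((2 : ℕ) : K) = 0 := by rw [← h]; exact ringChar.Nat.cast_ringChar
    exact NeZero.ne (2 : K) (by exact_mod_cast this)
  have iff : ∀ φ : NicholsAlgebra X (-1 : K) ≃ₗ[K] NicholsAlgebra X (-1 : K), IsShift (-1) t φ ↔
      ∀ v w, der (-1) t v = 0 → der (-1) t w = 0 →
        φ (v + w * e (-1) t) = w + v * e (-1) t := by
    intro φ
    simp only [IsShift, hord]
    constructor
    · intro h v w hv hw
      have := h (fun j => if j = 0 then v else w) (by intro j _; split_ifs <;> assumption)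
      simpa [Finset.sum_range_succ] using this
    · intro h v hv
      have := h (v 0) (v 1) (hv 0 (by omega)) (hv 1 (by omega))
      simpa [Finset.sum_range_succ] using this
  simp only [iff]
  let f : NicholsAlgebra X (-1 : K) →ₗ[K] NicholsAlgebra X (-1 : K) :=
    der (-1) t + LinearMap.mulRight K (e (-1) t) ∘ₗ
      (LinearMap.id - LinearMap.mulRight K (e (-1) t) ∘ₗ der (-1) t)
  have dec : ∀ v : NicholsAlgebra X (-1 : K), ∃ a b, der (-1) t a = 0 ∧ der (-1) t b = 0 ∧
      v = a + b * e (-1) t := fun v =>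
    ⟨v - der (-1) t v * e (-1) t, der (-1) t v,
      by rw [map_sub, der_mul_e t (der_der t v), sub_self], der_der t v, by abel⟩
  have hf : ∀ v w, der (-1) t v = 0 → der (-1) t w = 0 →
        f (v + w * e (-1) t) = w + v * e (-1) t := by
    intro v w hv hw
    simp [f, hv, hw, der_mul_e]
  have hff : f ∘ₗ f = LinearMap.id := by
    ext v
    obtain ⟨a, b, ha, hb, h⟩ := dec v
    rw [LinearMap.comp_apply, h, hf a b ha hb, hf b a hb ha, LinearMap.id_apply]
  refine ⟨LinearEquiv.ofLinearMap f f hff hff, hf, ?_⟩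
  intro ψ hψ
  ext v
  obtain ⟨a, b, ha, hb, h⟩ := dec v
  rw [h, hψ a b ha hb]
  exact (hf a b ha hb).symm

end Derivations

end Quotient

/-- The quandle with four elements given by the table of the operation `▷`. -/
inductive Q41
  | x1 | x2 | x3 | x4
  deriving DecidableEq

namespace Q41

/-- The operation `▷`, row by row. -/
def op : Q41 → Q41 → Q41
  | x1, x1 => x1 | x1, x2 => x3 | x1, x3 => x4 | x1, x4 => x2
  | x2, x1 => x4 | x2, x2 => x2 | x2, x3 => x1 | x2, x4 => x3
  | x3, x1 => x2 | x3, x2 => x4 | x3, x3 => x3 | x3, x4 => x1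
  | x4, x1 => x3 | x4, x2 => x1 | x4, x3 => x2 | x4, x4 => x4

instance : Quandle Q41 where
  act := op
  self_distrib := by intro x y z; cases x <;> cases y <;> cases z <;> rfl
  invAct x y := op x (op x y)
  left_inv := by intro x y; cases x <;> cases y <;> rfl
  right_inv := by intro x y; cases x <;> cases y <;> rfl
  fix := by intro x; cases x <;> rfl

end Q41

variable (K : Type*) [Field K]

/-- The Nichols algebra `𝔅(4B)`: quandle `Q41`, constant cocycle `-1`. -/
abbrev B4B : Type _ := NicholsAlgebra Q41 (-1 : K)

/-- The shift `φ_t` of `𝔅(4B)`. -/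
noncomputable def shift [NeZero (2 : K)] (t : Q41) : B4B K ≃ₗ[K] B4B K :=
  (existsUnique_isShift t).choose

theorem isShift_shift [NeZero (2 : K)] (t : Q41) : IsShift (-1 : K) t (shift K t) :=
  (existsUnique_isShift t).choose_spec.1

/-- The shift group `Φ` of `𝔅(4B)`, generated by the shifts `φ_t`. -/
noncomputable def shiftGroup [NeZero (2 : K)] : Subgroup (B4B K ≃ₗ[K] B4B K) :=
  Subgroup.closure (Set.range (shift K))

/-- The Jordan block of size three with eigenvalue `μ`. -/
def jordanBlock {L : Type*} [Field L] (μ : L) : Matrix (Fin 3) (Fin 3) L :=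
  !![μ, 1, 0; 0, μ, 1; 0, 0, μ]

end RackNichols

/-! The proof turns everything into integer linear algebra on an explicit model `K^72` of the
Nichols algebra. Tables with entries `0, ±1` describe left and right multiplication by `e_t` and the
derivation `∂_t`; the relations between them are integer identities decided by computation. Letting
`TV` act on the unit vector defines `toReg : TV → K^72`.

The kernel of `toReg` is the Nichols ideal. Parents of basis words make `toReg` surjective. Any
ideal satisfying `IsNicholsIdeal` is stable under all `∂_t` and killed by the counit; since every
coordinate of `K^72` is generated from the counit by composing with derivations (`dual_eq_top`),
such an ideal lies in the kernel (`toReg_eq_zero_of_mem`). Conversely the kernel is itself such an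
ideal (`isNicholsIdeal_regKer`): right multiplication makes it two-sided, word length makes it
homogeneous, and `(id ⊗ ∂_t) Δ = Δ ∂_t` together with `dual_eq_top` makes it a coideal. Hence the
dimension is 72.

As `e_t² = 0`, the shift is `φ_t(v) = ∂_t(v) + v e_t`, so `N = φ₁φ₂` is also given by the tables.
Two computations determine it: `(N³ - 1)³ = 0`, and eight basis vectors generate the module over
`K[N]`. Since `72 = 8 · 9`, the module must be free of rank eight over `K[X]/(X³ - 1)³`. Once a
primitive third root of unity is available, the Chinese remainder theorem splits each summand into
three Jordan blocks of size three (`exists_basis_jordan`).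

Infinite order needs no root of unity: `N³` sends `b₃₇` to `b₃₇ - b₂₄` and fixes `b₂₄`, which in
characteristic zero excludes finite order. The shifts are involutions, and two involutions with
product of infinite order generate `C₂ ∗ C₂`. -/

namespace RackNichols

/-! ## Sparse integer vectors and matrices -/

/-- A sparse integer vector: a list of pairs of an index (counted from one) and a coefficient. -/
abbrev SVec := List (ℕ × ℤ)

/-- The list of the columns of a sparse matrix with entries `0, 1, -1`, preceded by an empty list.
A column is the list of the indices of its nonzero entries, with their signs. -/
abbrev Table := List (List ℤ)

namespace SVec

/-- Add one term to a sparse vector. -/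
def insertTerm (i : ℕ) (c : ℤ) : SVec → SVec
  | [] => [(i, c)]
  | (j, d) :: v => bif Nat.beq i j then (if c + d = 0 then v else (j, c + d) :: v)
      else (j, d) :: insertTerm i c v

/-- The sum `c v + w`. -/
def addScaled (c : ℤ) (v w : SVec) : SVec := v.foldr (fun p u => insertTerm p.1 (c * p.2) u) w

/-- The coefficient with index `i`. -/
def coord (i : ℕ) : SVec → ℤ
  | [] => 0
  | (j, d) :: v => bif Nat.beq i j then d + coord i v else coord i v

/-- Subtract multiples of the given vectors, each with entry one at the given index, so that these
entries of `v` become zero. -/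
def reduce (rows : List (ℕ × SVec)) (v : SVec) : SVec :=
  rows.foldl (fun v r => if coord r.1 v = 0 then v else addScaled (-coord r.1 v) r.2 v) v

/-- Insert a vector into an echelon form; it is dropped if no entry is `1` or `-1`. -/
def insertRow (rows : List (ℕ × SVec)) (v : SVec) : List (ℕ × SVec) :=
  let w := reduce rows v
  match w.find? fun p => p.2.natAbs.beq 1 with
  | none => rows
  | some p => rows ++ [(p.1, addScaled p.2 w [])]

end SVec

namespace Table

/-- The column with index `i`. -/
def col : Table → ℕ → SVec
  | [], _ => []
  | l :: _, 0 => l.map fun z => (z.natAbs, z.sign)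
  | _ :: T, i + 1 => col T i

/-- The product of a matrix and a vector. -/
def apply (T : Table) (v : SVec) : SVec :=
  v.foldr (fun p u => SVec.addScaled p.2 (T.col p.1) u) []

end Table

/-! ### Evaluation of sparse vectors and tables over a field -/

section Eval

variable (K : Type*) [Field K] (n : ℕ)

/-- The standard basis vector with index `i`, counted from one; zero unless `1 ≤ i ≤ n`. -/
def unitVec (i : ℕ) : Fin n → K := fun j => if (j : ℕ) + 1 = i then 1 else 0

/-- The vector represented by a sparse vector. -/
def SVec.eval (v : SVec) : Fin n → K := (v.map fun p => (p.2 : K) • unitVec K n p.1).sum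

/-- The endomorphism represented by a table. -/
noncomputable def Table.toLin (T : Table) : Module.End K (Fin n → K) :=
  Fintype.linearCombination K fun i : Fin n => (T.col (i + 1)).eval K n

/-- A table with at most `n` columns, not counting the initial empty list. -/
def Table.Fits (T : Table) : Prop := T.col 0 = [] ∧ T.length ≤ n + 1

instance (T : Table) : Decidable (T.Fits n) := by unfold Table.Fits; infer_instance

variable {K n}

theorem unitVec_succ (i : Fin n) : unitVec K n (i + 1) = Pi.single i 1 := by
  ext j
  simp [unitVec, Pi.single_apply, Fin.ext_iff]

theorem unitVec_eq_zero {i : ℕ} (h : i = 0 ∨ n < i) : unitVec K n i = 0 := by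
  ext j
  simp only [unitVec, Pi.zero_apply, ite_eq_right_iff, one_ne_zero, imp_false]
  omega

/-- Quantifying over the concrete list `List.range' 1 n` lets the decided table checks be used as
hypotheses directly. -/
theorem span_unitVec {S : Submodule K (Fin n → K)} (h : ∀ i ∈ List.range' 1 n, unitVec K n i ∈ S) :
    S = ⊤ := by
  rw [eq_top_iff, ← (Pi.basisFun K (Fin n)).span_eq, Submodule.span_le]
  rintro _ ⟨i, rfl⟩
  rw [Pi.basisFun_apply, ← unitVec_succ]
  exact h _ (by rw [List.mem_range'_1]; omega)

theorem linearMap_ext {P : Type*} [AddCommMonoid P] [Module K P] {f g : (Fin n → K) →ₗ[K] P}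
    (h : ∀ i ∈ List.range' 1 n, f (unitVec K n i) = g (unitVec K n i)) : f = g := by
  rw [← LinearMap.eqLocus_eq_top]
  exact span_unitVec h

namespace SVec

@[simp] theorem eval_nil : eval K n [] = 0 := rfl

@[simp] theorem eval_cons (p : ℕ × ℤ) (v : SVec) :
    eval K n (p :: v) = (p.2 : K) • unitVec K n p.1 + eval K n v := by
  simp [eval]

theorem eval_singleton (i : ℕ) : eval K n [(i, 1)] = unitVec K n i := by
  simp

theorem eval_insertTerm (i : ℕ) (c : ℤ) (v : SVec) :
    eval K n (insertTerm i c v) = (c : K) • unitVec K n i + eval K n v := by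
  induction v with
  | nil => simp [insertTerm]
  | cons p v ih =>
    obtain ⟨j, d⟩ := p
    rw [insertTerm]
    cases h : Nat.beq i j with
    | false => simp only [cond_false, eval_cons, ih]; abel
    | true =>
      obtain rfl := Nat.eq_of_beq_eq_true h
      rw [cond_true, eval_cons, ← add_assoc, ← add_smul, ← Int.cast_add]
      split_ifs with hc
      · simp [hc]
      · simp

@[simp] theorem eval_addScaled (c : ℤ) (v w : SVec) :
    eval K n (addScaled c v w) = (c : K) • eval K n v + eval K n w := by
  induction v with
  | nil => simp [addScaled]
  | cons p v ih =>
    rw [addScaled, List.foldr_cons, eval_insertTerm, ← addScaled, ih, eval_cons]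
    push_cast
    rw [smul_add, mul_smul, add_assoc]

theorem eval_apply (v : SVec) (i : Fin n) : eval K n v i = coord (i + 1) v := by
  induction v with
  | nil => simp [coord]
  | cons p v ih =>
    obtain ⟨j, d⟩ := p
    rw [coord, eval_cons, Pi.add_apply, ih, Pi.smul_apply, unitVec]
    cases h : Nat.beq (i + 1) j with
    | false => rw [if_neg (Nat.ne_of_beq_eq_false h)]; simp
    | true => rw [if_pos (Nat.eq_of_beq_eq_true h)]; simp

/-- Each reduction step adds a multiple of a row, and the rows lie in `S`. No echelon property is
needed. -/
theorem eval_reduce_mem {S : Submodule K (Fin n → K)} {rows : List (ℕ × SVec)}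
    (h : ∀ r ∈ rows, eval K n r.2 ∈ S) (v : SVec) :
    eval K n (reduce rows v) ∈ S ↔ eval K n v ∈ S := by
  induction rows generalizing v with
  | nil => rfl
  | cons r rows ih =>
    rw [reduce, List.foldl_cons, ← reduce, ih fun r hr => h r (List.mem_cons_of_mem _ hr)]
    split_ifs
    · rfl
    · rw [eval_addScaled, Submodule.add_mem_iff_right]
      exact S.smul_mem _ (h r List.mem_cons_self)

/-- Soundness only: a dropped vector costs nothing here, and whether enough rows survive is left to
the final reduction check. -/
theorem eval_insertRow_mem {S : Submodule K (Fin n → K)} {rows : List (ℕ × SVec)}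
    (h : ∀ r ∈ rows, eval K n r.2 ∈ S) {v : SVec} (hv : eval K n v ∈ S) :
    ∀ r ∈ insertRow rows v, eval K n r.2 ∈ S := by
  have hw := (eval_reduce_mem h v).mpr hv
  rw [insertRow]
  split
  · exact h
  · intro r hr
    rw [List.mem_append, List.mem_singleton] at hr
    rcases hr with hr | rfl
    · exact h r hr
    · simpa using S.smul_mem _ hw

theorem eval_foldl_insertRow_mem {S : Submodule K (Fin n → K)} {vs : List SVec}
    (hvs : ∀ v ∈ vs, eval K n v ∈ S) {rows : List (ℕ × SVec)} (h : ∀ r ∈ rows, eval K n r.2 ∈ S) :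
    ∀ r ∈ vs.foldl insertRow rows, eval K n r.2 ∈ S := by
  induction vs generalizing rows with
  | nil => exact h
  | cons v vs ih =>
    exact ih (fun v hv => hvs v (List.mem_cons_of_mem _ hv))
      (eval_insertRow_mem h (hvs v List.mem_cons_self))

/-- A subspace is everything if the unit vectors reduce to zero modulo an echelon form of some of
its elements. -/
theorem eq_top_of_reduce {S : Submodule K (Fin n → K)} {vs : List SVec}
    (hvs : ∀ v ∈ vs, eval K n v ∈ S)
    (h : ∀ i ∈ List.range' 1 n, reduce (vs.foldl insertRow []) [(i, 1)] = []) : S = ⊤ := by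
  refine span_unitVec fun i hi => ?_
  rw [← eval_singleton,
    ← eval_reduce_mem (eval_foldl_insertRow_mem hvs fun r hr => absurd hr List.not_mem_nil), h i hi]
  exact S.zero_mem

end SVec

namespace Table

theorem col_of_length_le {T : Table} {i : ℕ} (h : T.length ≤ i) : T.col i = [] := by
  induction T generalizing i with
  | nil => rfl
  | cons l T ih =>
    cases i with
    | zero => simp at h
    | succ i => exact ih (by simpa using h)

/-- `T.Fits n` makes the columns outside `1, …, n` empty, in agreement with `unitVec` being zero
there. Sparse vectors therefore need no bounds on their indices. -/
theorem toLin_unitVec {T : Table} (hT : T.Fits n) (i : ℕ) :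
    T.toLin K n (unitVec K n i) = (T.col i).eval K n := by
  by_cases h : i = 0 ∨ n < i
  · rw [unitVec_eq_zero h, map_zero]
    rcases h with rfl | h
    · rw [hT.1, SVec.eval_nil]
    · rw [col_of_length_le (hT.2.trans h), SVec.eval_nil]
  · obtain ⟨j, rfl⟩ : ∃ j : Fin n, (j : ℕ) + 1 = i := ⟨⟨i - 1, by omega⟩, by simp; omega⟩
    rw [unitVec_succ, toLin, Fintype.linearCombination_apply_single, one_smul]

theorem toLin_eval {T : Table} (hT : T.Fits n) (v : SVec) :
    T.toLin K n (v.eval K n) = (T.apply v).eval K n := by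
  induction v with
  | nil => simp [apply]
  | cons p v ih =>
    rw [apply, List.foldr_cons, ← apply, SVec.eval_addScaled, ← ih, SVec.eval_cons, map_add,
      map_smul, toLin_unitVec hT]

end Table

end Eval

/-! ## The regular representation of the Nichols algebra -/

namespace Q41

/-- Left multiplication by `e_t`. -/
def leftTable : Q41 → Table
  | .x1 =>
    [[], [2], [], [9], [12], [-6,-11], [14], [17], [-16], [], [21], [-14], [], [18,20,-23], [],
    [27], [], [], [26,-29], [31], [-26], [], [32,-33], [-29], [-36], [37], [], [], [38,-39], [],
    [-42], [], [-43], [-43], [-46], [47], [], [], [-49], [-49], [-52], [53], [], [], [-56], [57],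
    [], [], [51,-54,57], [], [-61], [62], [], [], [62], [65], [], [], [60,-66], [63,67], [68], [],
    [], [-69], [70], [], [68], [69], [], [], [], [72], []]
  | .x2 =>
    [[], [3], [6], [], [-7,-9], [-10,-13], [], [-14], [-15,-18], [14], [-19], [-22], [23], [19],
    [], [-25], [-28], [29], [25], [], [-25,-32], [33], [], [], [-30,-35], [], [-38], [39], [], [],
    [-41], [43], [], [], [-44,-45], [41], [-48], [49], [], [], [-50,-51], [], [-54], [], [-55],
    [55], [-58], [-51,-57], [], [], [-60], [60], [-63], [-62], [], [], [-66], [-60], [], [64,-65],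
    [], [-69], [], [], [-68], [-68], [], [71], [], [], [72], [], []]
  | .x3 =>
    [[], [4], [7], [10], [], [-8,-12], [15], [], [-17], [19], [], [-20,-21], [17], [-24], [25],
    [], [-26,-27], [], [-30], [], [-31], [31], [-34], [35], [], [], [-37], [37], [-40], [41], [],
    [], [-44], [45], [], [], [42,-47], [], [-50], [51], [], [], [-53], [55], [], [], [56,-57],
    [-53], [-59], [60], [], [], [61,-62], [], [-64], [], [-65], [-65], [-67], [], [], [-68],
    [-68], [-70], [], [], [-71], [], [], [-72], [], [], []]
  | .x4 =>
    [[], [5], [8], [11], [13], [], [16], [18], [], [20], [22], [], [24], [], [26], [28], [], [30],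
    [], [32], [], [34], [], [36], [], [38], [], [40], [], [42], [], [44], [], [46], [], [48], [],
    [50], [], [52], [], [54], [], [56], [], [58], [], [59], [], [61], [], [63], [], [64], [],
    [66], [], [67], [], [], [69], [], [70], [], [], [71], [], [], [72], [], [], [], []]

/-- The derivation `∂_t`. -/
def derTable : Q41 → Table
  | .x1 =>
    [[], [], [1], [], [], [], [3], [4], [5], [-4], [], [], [-5], [], [7,9], [10], [11], [8,12],
    [13], [], [-13], [13], [], [10,13], [], [19], [18,20], [-18,21], [22], [-15,-18,23], [24],
    [-24], [], [19], [], [-24], [22], [30,31], [32], [-25,33], [34], [30,35], [-28,36], [30,35],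
    [], [], [32], [-28,34,36], [], [-41,43], [44], [45], [-38,46], [-40,-42,47], [48], [], [48],
    [44,48], [], [], [55], [-54,56], [-50,-54,57], [58], [59], [59], [], [], [-64,65], [66], [67],
    [], [71]]
  | .x2 =>
    [[], [], [], [1], [], [], [-5], [], [], [2], [4], [5], [], [], [6,11], [8,12], [], [], [],
    [7], [8], [12], [13], [8], [], [15,-20,-21], [16], [-16], [24], [16], [], [17], [18],
    [-20,23], [24], [-17], [], [26,27], [28,-34], [28,-34,36], [], [-26,-27], [], [-26,29], [30],
    [31,35], [36], [], [-30], [-38,39,-46], [40], [-40,42,-47], [], [], [-40], [37,41], [42],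
    [47], [44,48], [], [50,51,-56,57], [52], [52], [-59], [], [53], [50,54], [59], [-61,62],
    [63,67], [], [64], [70]]
  | .x3 =>
    [[], [], [], [], [1], [], [], [-3], [], [], [-5], [], [2], [5], [], [11], [], [-9], [-11],
    [-10,-13], [], [6,11], [], [6], [8], [22], [], [-14], [], [-14], [-20], [-18,-20,-21,23],
    [-22], [-22], [16], [15,18,20], [16], [32,-33], [], [], [-26], [-25,-32], [-26], [32,-33],
    [-34,36], [28,34,-36], [], [27,-29], [28], [], [-46], [-38,46], [], [-37,43], [-38],
    [-44,-45,48], [-46], [38,-39,-46], [], [40,-42], [-58], [], [49], [], [-50,56], [51,-54,56],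
    [-58], [-52], [-60,66], [], [61], [63], [-69]]
  | .x4 =>
    [[], [], [], [], [], [1], [], [], [-4], [], [], [-2], [], [-3], [], [], [12], [], [-7,-9], [],
    [7], [], [6], [], [10], [], [-17], [], [-23], [], [19], [], [14], [], [-15], [], [-21], [],
    [29], [], [35], [], [-31], [], [-25], [], [27], [], [33], [], [-41], [], [-47], [], [43], [],
    [37], [], [-39], [-45], [], [53], [], [-51,-57], [-55], [], [-49], [51], [], [62], [-65],
    [60], [68]]

/-- Right multiplication by `e_t`. -/
def rightTable : Q41 → Table
  | .x1 =>
    [[], [2], [], [6], [7], [8], [], [], [], [14], [15], [16], [17], [18], [], [], [], [], [],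
    [25], [26], [27], [28], [29], [30], [], [], [], [], [], [], [37], [38], [39], [40], [41],
    [42], [], [], [], [], [], [], [49], [50], [51], [52], [53], [54], [], [], [], [], [], [],
    [60], [61], [62], [63], [64], [], [], [], [], [], [68], [69], [70], [], [], [], [72], []]
  | .x2 =>
    [[], [3], [9], [], [10], [11], [14], [19], [20], [], [], [], [21], [22], [], [25], [26], [31],
    [32], [], [], [], [], [33], [34], [], [], [37], [38], [43], [44], [], [], [], [], [45], [46],
    [], [], [49], [50], [55], [56], [], [], [], [], [57], [58], [], [], [60], [61], [65], [66],
    [], [], [], [], [67], [], [], [68], [69], [71], [], [], [], [], [], [72], [], []]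
  | .x3 =>
    [[], [4], [12], [-7,-9], [], [13], [23], [17], [24], [-17], [-19], [-18,-20], [], [], [-29],
    [35], [36], [], [30], [], [-30], [-31], [-32], [], [], [-41], [-42], [47], [48], [], [], [],
    [], [-43], [-44], [], [], [-53], [-54], [-51,-57], [59], [], [], [], [], [-55], [-56], [], [],
    [62], [-64], [65], [-63,-67], [], [], [], [], [-65], [-66], [], [-68], [70], [], [71], [], [],
    [], [-71], [], [-72], [], [], []]
  | .x4 =>
    [[], [5], [-6,-11], [-10,-13], [-8,-12], [], [22], [-15,20,21], [-16], [-18,-20,-21,23], [24],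
    [-22], [16], [-24], [32,-33], [-34], [], [-26,-27], [-28,34], [30,35], [-34,36], [-36], [],
    [-28], [], [-44,-45], [-46], [46], [], [38,-39], [-40], [-42,47], [48], [48], [], [40], [],
    [56,-57], [-58], [-58], [], [-50,-51], [-52], [-51,54,-57], [59], [-59], [], [-52], [],
    [60,-66], [-67], [67], [], [61,-62], [-63], [-64,65], [-63,-67], [-63,-67], [], [], [71],
    [69], [69], [], [-70], [-70], [71], [], [72], [], [], [], []]

/-- The `i`-th basis vector, `i ≥ 2`, is `e_s` times the `j`-th one, where `(s, j)` is the entry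
with index `i - 2`. -/
def parents : List (Q41 × ℕ) :=
    [(.x1, 1), (.x2, 1), (.x3, 1), (.x4, 1), (.x2, 2), (.x3, 2), (.x4, 2), (.x1, 3), (.x3, 3),
    (.x4, 3), (.x1, 4), (.x4, 4), (.x1, 6), (.x3, 6), (.x4, 6), (.x1, 7), (.x4, 7), (.x3, 9),
    (.x4, 9), (.x1, 10), (.x4, 10), (.x2, 12), (.x4, 12), (.x3, 14), (.x4, 14), (.x1, 15), (.x4,
    15), (.x2, 17), (.x4, 17), (.x1, 19), (.x4, 19), (.x2, 21), (.x4, 21), (.x3, 23), (.x4, 23),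
    (.x1, 25), (.x4, 25), (.x2, 27), (.x4, 27), (.x3, 29), (.x4, 29), (.x2, 31), (.x4, 31), (.x3,
    33), (.x4, 33), (.x1, 35), (.x4, 35), (.x2, 37), (.x4, 37), (.x3, 39), (.x4, 39), (.x1, 41),
    (.x4, 41), (.x3, 43), (.x4, 43), (.x1, 45), (.x4, 45), (.x4, 47), (.x3, 49), (.x4, 49), (.x1,
    51), (.x4, 51), (.x4, 53), (.x1, 55), (.x4, 55), (.x4, 57), (.x1, 60), (.x4, 60), (.x4, 62),
    (.x4, 65), (.x4, 68)]

/-- A positive multiple of the coordinate with index `i ≥ 2` is the signed sum of the functionals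
`c_j ∘ ∂_t` for `(t, ± j)` in the entry with index `i - 2`. -/
def coparents : List (List (Q41 × ℤ)) :=
    [[(.x1, 1)], [(.x2, 1)], [(.x3, 1)], [(.x4, 1)], [(.x1, 3)], [(.x3, -3)], [(.x4, -4)], [(.x2,
    2)], [(.x2, 4)], [(.x4, -2)], [(.x3, 2)], [(.x4, -3)], [(.x1, 7)], [(.x1, 10), (.x2, 12),
    (.x3, -6)], [(.x1, 11)], [(.x1, 8)], [(.x4, -9)], [(.x2, 7)], [(.x2, 8), (.x1, -10)], [(.x1,
    -10), (.x2, 12), (.x3, 6)], [(.x2, 13)], [(.x1, 10), (.x2, -12), (.x3, 6)], [(.x3, 8)], [(.x2,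
    15)], [(.x1, 20)], [(.x1, 21)], [(.x4, -23)], [(.x1, -15)], [(.x4, 19)], [(.x3, -21)], [(.x2,
    18)], [(.x2, 23)], [(.x4, -15)], [(.x3, 15)], [(.x4, -21)], [(.x1, 31)], [(.x4, 29)], [(.x1,
    -25)], [(.x4, 35)], [(.x3, -25)], [(.x4, -31)], [(.x2, 29)], [(.x4, -25)], [(.x2, 31)], [(.x4,
    27)], [(.x3, 27)], [(.x4, 33)], [(.x1, -41)], [(.x4, -41)], [(.x1, 45)], [(.x1, -38)], [(.x1,
    -40)], [(.x4, 43)], [(.x2, 37)], [(.x4, 37)], [(.x3, -39)], [(.x2, 44)], [(.x3, 40)], [(.x1,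
    55)], [(.x1, 56)], [(.x1, -50)], [(.x1, 58)], [(.x3, -50)], [(.x2, 53)], [(.x2, 54)], [(.x3,
    -52)], [(.x1, -64)], [(.x1, 66)], [(.x1, 67)], [(.x2, 64)], [(.x1, 71)]]

end Q41
-- The order of terms in a sparse vector is not normalized, so equality is tested by cancellation to
-- the empty list.
theorem SVec.eval_eq_of_sub {K : Type*} [Field K] {n : ℕ} {v w : SVec}
    (h : addScaled (-1) v w = []) : eval K n v = eval K n w := by
  have := congrArg (eval K n) h
  rw [eval_addScaled, eval_nil] at this
  simpa [neg_add_eq_zero] using this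

namespace Q41

theorem fits_leftTable (t : Q41) : (leftTable t).Fits 72 := by
  cases t <;> decide +kernel

theorem fits_derTable (t : Q41) : (derTable t).Fits 72 := by
  cases t <;> decide +kernel

theorem fits_rightTable (t : Q41) : (rightTable t).Fits 72 := by
  cases t <;> decide +kernel

/-- The automorphism `g_t` on sparse vectors. -/
def applyAct (t : Q41) (v : SVec) : SVec :=
  SVec.addScaled (-1) ((leftTable t).apply ((derTable t).apply v))
    ((derTable t).apply ((leftTable t).apply v))

/-- The shift `φ_t` on sparse vectors. -/
def applyShift (t : Q41) (v : SVec) : SVec :=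
  SVec.addScaled 1 ((derTable t).apply v) ((rightTable t).apply v)

/-- The product `φ₁ φ₂` on sparse vectors. -/
def applyProd (v : SVec) : SVec := applyShift x1 (applyShift x2 v)

/-- The endomorphism `(φ₁ φ₂)³ - 1` on sparse vectors. -/
def applyCubeSub (v : SVec) : SVec :=
  SVec.addScaled (-1) v (applyProd (applyProd (applyProd v)))

/-- The index of `e_t` in the basis. -/
def index : Q41 → ℕ
  | x1 => 2 | x2 => 3 | x3 => 4 | x4 => 5

/-- The lengths of the basis words. -/
def wordLength (i : ℕ) : ℕ :=
  (bif Nat.ble 2 i then 1 else 0) + (bif Nat.ble 6 i then 1 else 0) +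
  (bif Nat.ble 14 i then 1 else 0) + (bif Nat.ble 25 i then 1 else 0) +
  (bif Nat.ble 37 i then 1 else 0) + (bif Nat.ble 49 i then 1 else 0) +
  (bif Nat.ble 60 i then 1 else 0) + (bif Nat.ble 68 i then 1 else 0) +
  (bif Nat.ble 72 i then 1 else 0)

/-- Indices of basis vectors that generate the Nichols algebra as a module over `⟨φ₁ φ₂⟩`. -/
def generatorIndex (k : Fin 8) : ℕ := ([1, 2, 4, 7, 23, 29, 35, 41] : List ℕ).getD k 0

/-- The vectors `((φ₁ φ₂)³ - 1)^i (φ₁ φ₂)^j v`, where `i, j < 3` and `v` is one of the generators. -/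
def orbitVectors : List SVec :=
  [1, 2, 4, 7, 23, 29, 35, 41].flatMap fun i =>
    let v := [(i, 1)]
    let w := applyCubeSub v
    [v, w, applyCubeSub w].flatMap fun u => [u, applyProd u, applyProd (applyProd u)]

/-! ### Integer identities between the tables, decided by computation -/

section Tables

variable (s t : Q41)

theorem right_left_check : ∀ i ∈ List.range' 1 72,
    SVec.addScaled (-1) ((rightTable t).apply ((leftTable s).col i))
      ((leftTable s).apply ((rightTable t).col i)) = [] := by
  cases s <;> cases t <;> decide +kernel

/-- Only `s ≠ t` has content: for `s = t` the commutator of `∂_t` and `e_t` is the definition of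
`g_t`, whose own relation is `act_left_check`. -/
theorem der_left_check (h : s ≠ t) : ∀ i ∈ List.range' 1 72,
    SVec.addScaled (-1) ((derTable t).apply ((leftTable s).col i))
      ((leftTable s).apply ((derTable t).col i)) = [] := by
  cases s <;> cases t <;> first | exact absurd rfl h | decide +kernel

/-- The relation `g_t(e_s v) = -e_{t ▷ s} g_t(v)`; the scalar `1` in the sum accounts for the
cocycle `-1`. -/
theorem act_left_check : ∀ i ∈ List.range' 1 72,
    SVec.addScaled 1 (applyAct t ((leftTable s).col i))
      ((leftTable (op t s)).apply (applyAct t [(i, 1)])) = [] := by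
  cases s <;> cases t <;> decide +kernel

theorem right_one_check : (rightTable t).col 1 = (leftTable t).col 1 := by
  cases t <;> decide +kernel

theorem left_one_check : (leftTable t).col 1 = [(index t, 1)] := by
  cases t <;> decide +kernel

theorem der_one_check : (derTable t).col 1 = [] := by
  cases t <;> decide +kernel

theorem der_index_check : (derTable t).col (index t) = [(1, 1)] := by
  cases t <;> decide +kernel

/-- Source of the grading: the numbers of basis words by length are `1, 4, 8, 11, 12, 12, 11, 8, 4,
1`. -/
theorem wordLength_check : ∀ i ∈ List.range' 1 72, ∀ p ∈ (leftTable t).col i,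
    wordLength p.1 = wordLength i + 1 := by
  cases t <;> decide +kernel

theorem parents_check : ∀ i < 71, ∃ p ∈ parents[i]?, p.2 < i + 2 ∧
    (leftTable p.1).col p.2 = [(i + 2, 1)] := by
  decide +kernel

/-- Triangularity for the dual: the signed sum involves earlier coordinates only, and it vanishes on
every basis vector but the one with index `i + 2`. -/
theorem coparents_check : ∀ i < 71, ∃ l ∈ coparents[i]?,
    (∀ p ∈ l, p.2.natAbs - 1 < i + 1) ∧ ∀ k ∈ List.range' 1 72,
    ((l.map fun p => p.2.sign * ((derTable p.1).col k).coord (p.2.natAbs - 1 + 1)).sum = 0 ↔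
      k ≠ i + 2) := by
  decide +kernel

theorem cubeSub_check : ∀ i ∈ List.range' 1 72,
    applyCubeSub (applyCubeSub (applyCubeSub [(i, 1)])) = [] := by
  decide +kernel

/-- The witness that `(φ₁ φ₂)³` is not of finite order. -/
theorem cubeSub_ne_check : applyCubeSub [(37, 1)] = [(24, -1)] ∧
    applyCubeSub [(24, -1)] = [] := by
  decide +kernel

/-- The pivots are `±1`, so this integral elimination is valid over every field. -/
theorem orbitVectors_check : ∀ i ∈ List.range' 1 72,
    SVec.reduce (orbitVectors.foldl SVec.insertRow []) [(i, 1)] = [] := by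
  decide +kernel

end Tables

end Q41

theorem SVec.exists_mem_of_coord_ne_zero {i : ℕ} {v : SVec} (h : coord i v ≠ 0) :
    ∃ p ∈ v, p.1 = i := by
  induction v with
  | nil => exact absurd rfl h
  | cons p v ih =>
    obtain ⟨j, d⟩ := p
    rw [coord] at h
    cases hb : Nat.beq i j with
    | true => exact ⟨_, List.mem_cons_self, (Nat.eq_of_beq_eq_true hb).symm⟩
    | false =>
      rw [hb, cond_false] at h
      obtain ⟨p, hp, rfl⟩ := ih h
      exact ⟨p, List.mem_cons_of_mem _ hp, rfl⟩

theorem Table.toLin_apply {K : Type*} [Field K] {n : ℕ} (T : Table) (m : Fin n → K) (i : Fin n) :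
    T.toLin K n m i = ∑ k : Fin n, m k * (((T.col (k + 1)).coord (i + 1) : ℤ) : K) := by
  simp [toLin, Fintype.linearCombination_apply, Finset.sum_apply, SVec.eval_apply]

/-- Induction on elements of the free algebra, multiplying by generators on the left. -/
theorem freeAlgebra_induction_left {K X : Type*} [Field K] {p : FreeAlgebra K X → Prop}
    (one : p 1) (add : ∀ x y, p x → p y → p (x + y)) (smul : ∀ (c : K) x, p x → p (c • x))
    (ι_mul : ∀ s x, p x → p (FreeAlgebra.ι K s * x)) (x : FreeAlgebra K X) : p x := by
  suffices h : ∀ x y, p y → p (x * y) by simpa using h x 1 one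
  intro x
  induction x using FreeAlgebra.induction with
  | grade0 r => intro y hy; rw [← Algebra.smul_def]; exact smul r y hy
  | grade1 s => exact ι_mul s
  | mul a b ha hb => intro y hy; rw [mul_assoc]; exact ha _ (hb _ hy)
  | add a b ha hb => intro y hy; rw [add_mul]; exact add _ _ (ha _ hy) (hb _ hy)

/-! ### The map from the tensor algebra to the regular representation -/

namespace Q41

variable (K : Type*) [Field K]

/-- Left multiplication by `e_t` in the regular representation. -/
noncomputable def left (t : Q41) : Module.End K (Fin 72 → K) := (leftTable t).toLin K 72

/-- Right multiplication by `e_t` in the regular representation. -/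
noncomputable def right (t : Q41) : Module.End K (Fin 72 → K) := (rightTable t).toLin K 72

/-- The derivation `∂_t` in the regular representation. -/
noncomputable def deriv (t : Q41) : Module.End K (Fin 72 → K) := (derTable t).toLin K 72

/-- The automorphism `g_t` in the regular representation. -/
noncomputable def twist (t : Q41) : Module.End K (Fin 72 → K) :=
  deriv K t * left K t - left K t * deriv K t

/-- The unit of the Nichols algebra in the regular representation. -/
def unit : Fin 72 → K := unitVec K 72 1

/-- The map from the tensor algebra to the regular representation. -/
noncomputable def toReg : FreeAlgebra K Q41 →ₗ[K] (Fin 72 → K) :=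
  (LinearMap.applyₗ (unit K)).comp
    (FreeAlgebra.lift K (left K) : FreeAlgebra K Q41 →ₐ[K] _).toLinearMap

variable {K}

theorem left_eval (t : Q41) (v : SVec) :
    left K t (v.eval K 72) = ((leftTable t).apply v).eval K 72 :=
  Table.toLin_eval (fits_leftTable t) v

theorem right_eval (t : Q41) (v : SVec) :
    right K t (v.eval K 72) = ((rightTable t).apply v).eval K 72 :=
  Table.toLin_eval (fits_rightTable t) v

theorem deriv_eval (t : Q41) (v : SVec) :
    deriv K t (v.eval K 72) = ((derTable t).apply v).eval K 72 :=
  Table.toLin_eval (fits_derTable t) v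

theorem left_unitVec (t : Q41) (i : ℕ) :
    left K t (unitVec K 72 i) = ((leftTable t).col i).eval K 72 :=
  Table.toLin_unitVec (fits_leftTable t) i

theorem right_unitVec (t : Q41) (i : ℕ) :
    right K t (unitVec K 72 i) = ((rightTable t).col i).eval K 72 :=
  Table.toLin_unitVec (fits_rightTable t) i

theorem deriv_unitVec (t : Q41) (i : ℕ) :
    deriv K t (unitVec K 72 i) = ((derTable t).col i).eval K 72 :=
  Table.toLin_unitVec (fits_derTable t) i

theorem twist_eval (t : Q41) (v : SVec) :
    twist K t (v.eval K 72) = (applyAct t v).eval K 72 := by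
  rw [twist, LinearMap.sub_apply, Module.End.mul_apply, Module.End.mul_apply, left_eval,
    deriv_eval, deriv_eval, left_eval, applyAct, SVec.eval_addScaled]
  push_cast
  rw [neg_one_smul, neg_add_eq_sub]

theorem right_left (s t : Q41) (m : Fin 72 → K) :
    right K t (left K s m) = left K s (right K t m) := by
  refine LinearMap.congr_fun (f := right K t * left K s) (g := left K s * right K t)
    (linearMap_ext fun i hi => ?_) m
  rw [Module.End.mul_apply, Module.End.mul_apply, left_unitVec, right_unitVec, right_eval,
    left_eval]
  exact SVec.eval_eq_of_sub (right_left_check s t i hi)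

theorem deriv_left (s t : Q41) (m : Fin 72 → K) :
    deriv K t (left K s m) = left K s (deriv K t m) + if s = t then twist K t m else 0 := by
  split_ifs with h
  · subst h
    simp [twist]
  · rw [add_zero]
    refine LinearMap.congr_fun (f := deriv K t * left K s) (g := left K s * deriv K t)
      (linearMap_ext fun i hi => ?_) m
    rw [Module.End.mul_apply, Module.End.mul_apply, left_unitVec, deriv_unitVec, deriv_eval,
      left_eval]
    exact SVec.eval_eq_of_sub (der_left_check s t h i hi)

theorem twist_left (s t : Q41) (m : Fin 72 → K) :
    twist K t (left K s m) = -left K (t ◃ s) (twist K t m) := by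
  refine LinearMap.congr_fun (f := twist K t * left K s) (g := -(left K (t ◃ s) * twist K t))
    (linearMap_ext fun i hi => ?_) m
  have h := congrArg (SVec.eval K 72) (act_left_check s t i hi)
  rw [SVec.eval_addScaled, SVec.eval_nil, ← twist_eval, ← left_unitVec, ← left_eval, ← twist_eval,
    SVec.eval_singleton, Int.cast_one, one_smul] at h
  exact eq_neg_of_add_eq_zero_left h

theorem left_unit (t : Q41) : left K t (unit K) = unitVec K 72 (index t) := by
  rw [unit, left_unitVec, left_one_check, SVec.eval_singleton]

theorem right_unit (t : Q41) : right K t (unit K) = left K t (unit K) := by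
  rw [unit, left_unitVec, right_unitVec, right_one_check]

theorem deriv_unit (t : Q41) : deriv K t (unit K) = 0 := by
  rw [unit, deriv_unitVec, der_one_check, SVec.eval_nil]

theorem twist_unit (t : Q41) : twist K t (unit K) = unit K := by
  rw [twist, LinearMap.sub_apply, Module.End.mul_apply, Module.End.mul_apply, deriv_unit,
    left_unit, deriv_unitVec, der_index_check, SVec.eval_singleton, map_zero, sub_zero, unit]

theorem toReg_one : toReg K 1 = unit K := by
  simp [toReg]

theorem toReg_mul (x y : FreeAlgebra K Q41) :
    toReg K (x * y) = FreeAlgebra.lift K (left K) x (toReg K y) := by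
  simp [toReg]

theorem toReg_ι_mul (s : Q41) (x : FreeAlgebra K Q41) :
    toReg K (FreeAlgebra.ι K s * x) = left K s (toReg K x) := by
  rw [toReg_mul, FreeAlgebra.lift_ι_apply]

theorem toReg_ι (s : Q41) : toReg K (FreeAlgebra.ι K s) = unitVec K 72 (index s) := by
  rw [← mul_one (FreeAlgebra.ι K s), toReg_ι_mul, toReg_one, left_unit]

/-- Right multiplication commutes with the left action and agrees with it on the unit, so induction
on words applies. -/
theorem toReg_mul_ι (t : Q41) (x : FreeAlgebra K Q41) :
    toReg K (x * FreeAlgebra.ι K t) = right K t (toReg K x) := by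
  induction x using freeAlgebra_induction_left with
  | one => rw [one_mul, toReg_ι, toReg_one, right_unit, left_unit]
  | add x y hx hy => rw [add_mul, map_add, map_add, map_add, hx, hy]
  | smul c x hx => rw [smul_mul_assoc, map_smul, map_smul, map_smul, hx]
  | ι_mul s x hx => rw [mul_assoc, toReg_ι_mul, toReg_ι_mul, hx, right_left]

theorem toReg_act (t : Q41) (x : FreeAlgebra K Q41) :
    toReg K (act (-1) t x) = twist K t (toReg K x) := by
  induction x using freeAlgebra_induction_left with
  | one => rw [map_one, toReg_one, twist_unit]
  | add x y hx hy => simp only [map_add, hx, hy]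
  | smul c x hx => simp only [map_smul, hx]
  | ι_mul s x hx =>
    rw [map_mul, act_ι, smul_mul_assoc, map_smul, toReg_ι_mul, toReg_ι_mul, hx, twist_left,
      neg_one_smul]

/-- Both sides vanish at `1` and obey the same twisted Leibniz rule under left multiplication by a
generator. -/
theorem toReg_derT (t : Q41) (x : FreeAlgebra K Q41) :
    toReg K (derT (-1) t x) = deriv K t (toReg K x) := by
  induction x using freeAlgebra_induction_left with
  | one => rw [derT_one, map_zero, toReg_one, deriv_unit]
  | add x y hx hy => simp only [map_add, hx, hy]
  | smul c x hx => simp only [map_smul, hx]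
  | ι_mul s x hx =>
    rw [derT_ι_mul, map_add, toReg_ι_mul, toReg_ι_mul, hx, deriv_left]
    split_ifs
    · rw [toReg_act]
    · rw [map_zero]

theorem left_homogeneous (s : Q41) {n : ℕ} {m : Fin 72 → K}
    (hm : ∀ i : Fin 72, wordLength (i + 1) ≠ n → m i = 0) (i : Fin 72)
    (hi : wordLength (i + 1) ≠ n + 1) :
    left K s m i = 0 := by
  rw [left, Table.toLin_apply]
  refine Finset.sum_eq_zero fun k _ => ?_
  by_cases h : ((leftTable s).col (k + 1)).coord (i + 1) = 0
  · rw [h, Int.cast_zero, mul_zero]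
  · obtain ⟨p, hp, hpi⟩ := SVec.exists_mem_of_coord_ne_zero h
    have := wordLength_check s (k + 1) (by rw [List.mem_range'_1]; omega) p hp
    rw [hm k (by rw [hpi] at this; omega), zero_mul]

theorem toReg_homogeneous {n : ℕ} {x : FreeAlgebra K Q41} (hx : x ∈ degreePart K Q41 n)
    (i : Fin 72) (hi : wordLength (i + 1) ≠ n) : toReg K x i = 0 := by
  induction n generalizing x i with
  | zero =>
    rw [degreePart, pow_zero] at hx
    obtain ⟨c, rfl⟩ := Submodule.mem_one.mp hx
    rw [Algebra.algebraMap_eq_smul_one, map_smul, toReg_one, unit, Pi.smul_apply, unitVec, if_neg,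
      smul_zero]
    intro h
    rw [h] at hi
    exact hi rfl
  | succ n ih =>
    rw [degreePart, pow_succ'] at hx
    induction hx using Submodule.mul_induction_on' with
    | add x _ y _ hx hy => rw [map_add, Pi.add_apply, hx, hy, add_zero]
    | mem_mul_mem a ha b hb =>
      induction ha using Submodule.span_induction with
      | mem a ha =>
        obtain ⟨s, rfl⟩ := ha
        rw [toReg_ι_mul]
        exact left_homogeneous s (fun i hi => ih hb i hi) i hi
      | zero => simp
      | add x y _ _ hx hy => rw [add_mul, map_add, Pi.add_apply, hx, hy, add_zero]
      | smul c x _ hx => rw [smul_mul_assoc, map_smul, Pi.smul_apply, hx, smul_zero]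

/-- Coordinate `0` belongs to the unit, the only basis vector of word length zero; left
multiplication by a generator never reaches it. -/
theorem toReg_zero_apply (x : FreeAlgebra K Q41) :
    toReg K x 0 = FreeAlgebra.algebraMapInv x := by
  induction x using freeAlgebra_induction_left with
  | one => simp [toReg_one, unit, unitVec]
  | add x y hx hy => simp only [map_add, Pi.add_apply, hx, hy]
  | smul c x hx => simp only [map_smul, Pi.smul_apply, hx]
  | ι_mul s x hx =>
    rw [toReg_ι_mul, map_mul, algebraMapInv_ι, zero_mul, left, Table.toLin_apply]
    refine Finset.sum_eq_zero fun k _ => ?_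
    by_cases h : ((leftTable s).col (k + 1)).coord ((0 : Fin 72) + 1) = 0
    · rw [h, Int.cast_zero, mul_zero]
    · obtain ⟨p, hp, hpi⟩ := SVec.exists_mem_of_coord_ne_zero h
      have := wordLength_check s (k + 1) (by rw [List.mem_range'_1]; omega) p hp
      rw [hpi] at this
      exact absurd this (Nat.zero_ne_add_one _)

/-- The regular representation is generated by the unit. -/
theorem toReg_surjective : Function.Surjective (toReg K) := by
  rw [← LinearMap.range_eq_top]
  refine span_unitVec fun i hi => ?_
  rw [List.mem_range'_1] at hi
  induction i using Nat.strong_induction_on with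
  | h i ih =>
    obtain h | ⟨j, rfl⟩ : i = 1 ∨ ∃ j, i = j + 2 := by
      rcases hi with ⟨h1, -⟩
      rcases i with _ | _ | j
      · omega
      · exact Or.inl rfl
      · exact Or.inr ⟨j, rfl⟩
    · subst h
      exact ⟨1, toReg_one⟩
    · obtain ⟨p, -, hp, hc⟩ := parents_check j (by omega)
      -- A parent with index zero is impossible: column zero is empty.
      by_cases h0 : p.2 = 0
      · have := (fits_leftTable p.1).1
        rw [h0] at hc
        rw [this] at hc
        exact absurd hc (List.cons_ne_nil _ _).symm
      · obtain ⟨x, hx⟩ := ih p.2 hp (by omega)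
        refine ⟨FreeAlgebra.ι K p.1 * x, ?_⟩
        rw [toReg_ι_mul, hx, left_unitVec, hc, SVec.eval_singleton]

/-- A subspace of the dual of the regular representation that contains the counit and is stable
under the transposes of the derivations is everything. -/
theorem dual_eq_top [CharZero K] {S : Submodule K ((Fin 72 → K) →ₗ[K] K)}
    (h0 : LinearMap.proj 0 ∈ S) (hS : ∀ f ∈ S, ∀ t, f ∘ₗ deriv K t ∈ S) : S = ⊤ := by
  have key : ∀ (i : ℕ) (hi : i < 72), (LinearMap.proj ⟨i, hi⟩ : (Fin 72 → K) →ₗ[K] K) ∈ S := by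
    intro i
    induction i using Nat.strong_induction_on with
    | h i ih =>
      intro hi
      rcases i with _ | i
      · exact h0
      · obtain ⟨l, -, hl, hc⟩ := coparents_check i (by omega)
        let c (k : ℕ) : ℤ :=
          (l.map fun p => p.2.sign * ((derTable p.1).col k).coord (p.2.natAbs - 1 + 1)).sum
        -- The functional for `l` is assembled term by term; `natAbs - 1` converts a table index,
        -- counted from one, to an index in `Fin 72`.
        have hmem : ∀ l' : List (Q41 × ℤ), (∀ p ∈ l', p.2.natAbs - 1 < i + 1) →
            ∃ f ∈ S, ∀ k : Fin 72, f (Pi.single k 1) = (((l'.map fun p =>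
              p.2.sign * ((derTable p.1).col (k + 1)).coord (p.2.natAbs - 1 + 1)).sum : ℤ) : K) := by
          intro l' hl'
          induction l' with
          | nil => exact ⟨0, S.zero_mem, fun k => by simp⟩
          | cons p l' ih' =>
            obtain ⟨f, hf, hfk⟩ := ih' fun p hp => hl' p (List.mem_cons_of_mem _ hp)
            have hp := hl' p List.mem_cons_self
            refine ⟨(p.2.sign : K) • (LinearMap.proj ⟨p.2.natAbs - 1, hp.trans hi⟩ ∘ₗ deriv K p.1)
              + f, S.add_mem (S.smul_mem _ (hS _ (ih _ hp (hp.trans hi)) _)) hf, fun k => ?_⟩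
            rw [LinearMap.add_apply, hfk, ← unitVec_succ, LinearMap.smul_apply,
              LinearMap.comp_apply, deriv_unitVec, LinearMap.proj_apply, SVec.eval_apply]
            simp
        obtain ⟨f, hf, hfk⟩ := hmem l hl
        -- The multiple need not be `1` (it is `2` for the basis vector with index 15), so
        -- characteristic zero is used to cancel it.
        have hci : (c (i + 2) : K) ≠ 0 := by
          rw [Int.cast_ne_zero]
          intro h
          exact (hc (i + 2) (by rw [List.mem_range'_1]; omega)).mp h rfl
        have : f = (c (i + 2) : K) • LinearMap.proj ⟨i + 1, hi⟩ := by
          refine linearMap_ext fun k hk => ?_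
          obtain ⟨j, rfl⟩ : ∃ j : Fin 72, (j : ℕ) + 1 = k := by
            rw [List.mem_range'_1] at hk
            exact ⟨⟨k - 1, by omega⟩, by simp; omega⟩
          rw [unitVec_succ, hfk]
          by_cases hj : j = ⟨i + 1, hi⟩
          · subst hj
            simp [c]
          · have := (hc (j + 1) hk).mpr fun h => hj (Fin.ext (by simpa using h))
            rw [this]
            simp [Ne.symm hj]
        rw [this] at hf
        exact (S.smul_mem_iff hci).mp hf
  rw [eq_top_iff]
  intro f _
  have : f = ∑ i : Fin 72, f (Pi.single i 1) • LinearMap.proj i := by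
    refine LinearMap.pi_ext' fun i => LinearMap.ext_ring ?_
    simp [Pi.single_apply]
  rw [this]
  exact S.sum_mem fun i _ => S.smul_mem _ (key i i.2)

end Q41

theorem iSup_degreePart {K X : Type*} [Field K] : ⨆ n, degreePart K X n = ⊤ := by
  rw [eq_top_iff]
  intro x _
  induction x using freeAlgebra_induction_left with
  | one =>
    refine Submodule.mem_iSup_of_mem 0 ?_
    rw [degreePart, pow_zero]
    exact Submodule.one_le.mp le_rfl
  | add x y hx hy => exact Submodule.add_mem _ (hx trivial) (hy trivial)
  | smul c x hx => exact Submodule.smul_mem _ _ (hx trivial)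
  | ι_mul s x hx =>
    refine Submodule.iSup_induction _ (motive := fun x => FreeAlgebra.ι K s * x ∈ _) (hx trivial)
      (fun n x hx => ?_) ?_ fun x y hx hy => ?_
    · refine Submodule.mem_iSup_of_mem (n + 1) ?_
      rw [degreePart, pow_succ']
      exact Submodule.mul_mem_mul (Submodule.subset_span ⟨s, rfl⟩) hx
    · rw [mul_zero]; exact Submodule.zero_mem _
    · rw [mul_add]; exact Submodule.add_mem _ hx hy

/-! ### Derivations and the comultiplication of the tensor algebra -/

section Coassociativity

variable {K : Type*} [Field K] {X : Type*} [Quandle X]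

/-- Self-distributivity of the quandle, extended multiplicatively: `g_t g_s = g_{t ▷ s} g_t`. -/
theorem act_act (q : K) (s t : X) (x : FreeAlgebra K X) :
    act q t (act q s x) = act q (t ◃ s) (act q t x) := by
  induction x using freeAlgebra_induction_left with
  | one => simp
  | add x y hx hy => simp only [map_add, hx, hy]
  | smul c x hx => simp only [map_smul, hx]
  | ι_mul r x hx =>
    simp only [map_mul, act_ι, map_smul, hx]
    rw [← Shelf.self_distrib]

theorem comulGen_tmul (q : K) (s : X) (a b : FreeAlgebra K X) :
    comulGen q s (a ⊗ₜ b) =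
      (FreeAlgebra.ι K s * a) ⊗ₜ b + act q s a ⊗ₜ (FreeAlgebra.ι K s * b) := by
  simp [comulGen, braidGen]

/-- `g_t` carries the recursion for `Δ` at `e_s` to `q` times the one at `e_{t ▷ s}`, by `act_act`.
This handles the twisted term of the Leibniz rule in `lTensor_derT_comul`. -/
theorem comul_act (q : K) (t : X) (x : FreeAlgebra K X) :
    comul q (act q t x) =
      TensorProduct.map (act q t).toLinearMap (act q t).toLinearMap (comul q x) := by
  have key : ∀ (s : X) (z : FreeAlgebra K X ⊗[K] FreeAlgebra K X),
      TensorProduct.map (act q t).toLinearMap (act q t).toLinearMap (comulGen q s z) =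
        q • comulGen q (t ◃ s)
          (TensorProduct.map (act q t).toLinearMap (act q t).toLinearMap z) := by
    intro s z
    induction z with
    | zero => simp
    | add x y hx hy => simp only [map_add, hx, hy, smul_add]
    | tmul a b =>
      simp only [comulGen_tmul, map_add, TensorProduct.map_tmul, AlgHom.toLinearMap_apply, map_mul,
        act_ι, smul_mul_assoc, smul_add, ← TensorProduct.smul_tmul', TensorProduct.tmul_smul,
        act_act q s t]
  induction x using freeAlgebra_induction_left with
  | one => simp [comul_one]
  | add x y hx hy => simp only [map_add, hx, hy]
  | smul c x hx => simp only [map_smul, hx]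
  | ι_mul s x hx =>
    rw [map_mul, act_ι, smul_mul_assoc, map_smul, comul_ι_mul, comul_ι_mul, hx, key]

/-- Coassociativity in the form `(id ⊗ ∂_t) Δ = Δ ∂_t`. -/
theorem lTensor_derT_comul [DecidableEq X] (q : K) (t : X) (x : FreeAlgebra K X) :
    LinearMap.lTensor _ (derT q t) (comul q x) = comul q (derT q t x) := by
  have key : ∀ (s : X) (z : FreeAlgebra K X ⊗[K] FreeAlgebra K X),
      LinearMap.lTensor _ (derT q t) (comulGen q s z) =
        comulGen q s (LinearMap.lTensor _ (derT q t) z) +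
          if s = t then TensorProduct.map (act q t).toLinearMap (act q t).toLinearMap z else 0 := by
    intro s z
    induction z with
    | zero => simp
    | add x y hx hy =>
      simp only [map_add, hx, hy]
      split_ifs <;> abel
    | tmul a b =>
      simp only [comulGen_tmul, map_add, LinearMap.lTensor_tmul, derT_ι_mul, TensorProduct.tmul_add]
      split_ifs with h
      · subst h
        simp [add_assoc]
      · simp
  induction x using freeAlgebra_induction_left with
  | one => simp [comul_one, derT_one]
  | add x y hx hy => simp only [map_add, hx, hy]
  | smul c x hx => simp only [map_smul, hx]
  | ι_mul s x hx =>
    rw [comul_ι_mul, key, hx, derT_ι_mul, map_add, comul_ι_mul]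
    split_ifs
    · rw [comul_act]
    · rw [map_zero]

theorem derT_nicholsIdeal [DecidableEq X] {q : K} {x : FreeAlgebra K X} (hx : x ∈ nicholsIdeal q)
    (t : X) : derT q t x ∈ nicholsIdeal q := by
  rw [← proj_eq_zero, ← der_proj, proj_eq_zero.mpr hx, map_zero]

end Coassociativity

/-! ### The Nichols ideal as the kernel of the regular representation -/

namespace Q41

variable {K : Type*} [Field K]

variable (K) in
/-- The kernel of the map to the regular representation. -/
noncomputable def regKer : Ideal (FreeAlgebra K Q41) where
  carrier := {x | toReg K x = 0}
  add_mem' hx hy := by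
    rw [Set.mem_ofPred_eq] at *
    rw [map_add, hx, hy, add_zero]
  zero_mem' := map_zero _
  smul_mem' a x hx := by
    rw [Set.mem_ofPred_eq] at *
    rw [smul_eq_mul, toReg_mul, hx, map_zero]

theorem mem_regKer {x : FreeAlgebra K Q41} : x ∈ regKer K ↔ toReg K x = 0 := Iff.rfl

theorem exists_eq_add_mul (t : Q41) (v : B4B K) : ∃ a b : B4B K,
    der (-1) t a = 0 ∧ der (-1) t b = 0 ∧ v = a + b * e (-1) t :=
  ⟨v - der (-1) t v * e (-1) t, der (-1) t v,
    by rw [map_sub, der_mul_e t (der_der t v), sub_self], der_der t v, by abel⟩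

variable [CharZero K]

/-- The functionals that vanish on the image of the ideal include the counit and are stable under
composition with derivations, so `dual_eq_top` makes them everything. -/
theorem toReg_eq_zero_of_mem {x : FreeAlgebra K Q41} (hx : x ∈ nicholsIdeal (-1 : K)) :
    toReg K x = 0 := by
  let S : Submodule K ((Fin 72 → K) →ₗ[K] K) :=
    { carrier := {f | ∀ x ∈ nicholsIdeal (-1 : K), f (toReg K x) = 0}
      add_mem' := fun hf hg x hx => by rw [LinearMap.add_apply, hf x hx, hg x hx, add_zero]
      zero_mem' := fun x _ => rfl
      smul_mem' := fun c f hf x hx => by rw [LinearMap.smul_apply, hf x hx, smul_zero] }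
  have hS : S = ⊤ := by
    refine dual_eq_top (fun x hx => ?_) fun f hf t x hx => ?_
    · rw [LinearMap.proj_apply, toReg_zero_apply, algebraMapInv_nicholsIdeal hx]
    · rw [LinearMap.comp_apply, ← toReg_derT]
      exact hf _ (derT_nicholsIdeal hx t)
  ext i
  have : LinearMap.proj i ∈ S := hS ▸ Submodule.mem_top
  exact this x hx

/-- It suffices to apply every functional `f` to the second factor. For the counit the result is
`toReg K x = 0`; passing from `f` to `f ∘ ∂_t` replaces `x` by `∂_t x`, again in the kernel, by
coassociativity. Then `dual_eq_top` applies. -/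
theorem map_toReg_comul {x : FreeAlgebra K Q41} (hx : toReg K x = 0) :
    TensorProduct.map (toReg K) (toReg K) (comul (-1) x) = 0 := by
  let F (f : (Fin 72 → K) →ₗ[K] K) : FreeAlgebra K Q41 →ₗ[K] (Fin 72 → K) :=
    (TensorProduct.rid K _).toLinearMap ∘ₗ LinearMap.lTensor _ f ∘ₗ
      TensorProduct.map (toReg K) (toReg K) ∘ₗ comul (-1)
  let S : Submodule K ((Fin 72 → K) →ₗ[K] K) :=
    { carrier := {f | ∀ x, toReg K x = 0 → F f x = 0}
      add_mem' := fun hf hg x hx => by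
        have := hf x hx
        have := hg x hx
        simp_all [F, LinearMap.lTensor_add]
      zero_mem' := fun x _ => by simp [F]
      smul_mem' := fun c f hf x hx => by
        have := hf x hx
        simp_all [F, LinearMap.lTensor_smul] }
  have hS : S = ⊤ := by
    refine dual_eq_top (fun x hx => ?_) fun f hf t x hx => ?_
    · have : ∀ z, TensorProduct.rid K (Fin 72 → K) (LinearMap.lTensor _ (LinearMap.proj 0)
          (TensorProduct.map (toReg K) (toReg K) z)) = toReg K (TensorProduct.rid K _
            (LinearMap.lTensor _
            (FreeAlgebra.algebraMapInv : FreeAlgebra K Q41 →ₐ[K] K).toLinearMap z)) := by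
        intro z
        induction z with
        | zero => simp
        | add x y hx hy => simp only [map_add, hx, hy]
        | tmul a b => simp [toReg_zero_apply]
      refine (this _).trans ?_
      rw [rid_algebraMapInv_comul, hx]
    · have : ∀ z, LinearMap.lTensor (Fin 72 → K) (f ∘ₗ deriv K t)
          (TensorProduct.map (toReg K) (toReg K) z) = LinearMap.lTensor _ f
            (TensorProduct.map (toReg K) (toReg K) (LinearMap.lTensor _ (derT (-1) t) z)) := by
        intro z
        induction z with
        | zero => simp
        | add x y hx hy => simp only [map_add, hx, hy]
        | tmul a b => simp [toReg_derT]
      have hd := hf (derT (-1) t x) (by rw [toReg_derT, hx, map_zero])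
      refine (congrArg _ (this _)).trans ?_
      rw [lTensor_derT_comul]
      exact hd
  -- A tensor in `K^72 ⊗ K^72` is determined by its contractions with the coordinates of the second
  -- factor.
  refine (TensorProduct.piScalarRight K K (Fin 72 → K) (Fin 72)).injective ?_
  rw [map_zero]
  ext1 i
  have h : F (LinearMap.proj i) x = 0 := (hS ▸ Submodule.mem_top : LinearMap.proj i ∈ S) x hx
  refine Eq.trans ?_ h
  have : ∀ z, TensorProduct.piScalarRight K K (Fin 72 → K) (Fin 72) z i =
      TensorProduct.rid K _ (LinearMap.lTensor _ (LinearMap.proj i) z) := by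
    intro z
    induction z with
    | zero => simp
    | add x y hx hy => simp only [map_add, Pi.add_apply, hx, hy]
    | tmul a b => simp
  exact this _

theorem isNicholsIdeal_regKer : IsNicholsIdeal (-1 : K) (regKer K) where
  isTwoSided := by
    refine ⟨fun {a} b ha => ?_⟩
    induction b using FreeAlgebra.induction generalizing a with
    | grade0 r =>
      rw [← Algebra.commutes, ← Algebra.smul_def, mem_regKer, map_smul, mem_regKer.mp ha, smul_zero]
    | grade1 s => rw [mem_regKer, toReg_mul_ι, mem_regKer.mp ha, map_zero]
    | mul b c hb hc => rw [← mul_assoc]; exact hc (hb ha)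
    | add b c hb hc => rw [mul_add]; exact add_mem (hb ha) (hc ha)
  homogeneous := by
    intro x hx
    obtain ⟨f, hf, rfl⟩ := (Submodule.mem_iSup_iff_exists_finsupp _ _).mp
      (iSup_degreePart (K := K) (X := Q41) ▸ Submodule.mem_top : x ∈ ⨆ n, degreePart K Q41 n)
    refine Submodule.sum_mem _ fun n _ => Submodule.mem_iSup_of_mem n ⟨?_, hf n⟩
    change toReg K (f n) = 0
    change toReg K (f.sum fun _ x => x) = 0 at hx
    ext i
    -- Different degrees have images with disjoint supports, so at such a coordinate only `f n`
    -- contributes.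
    by_cases hi : wordLength (i + 1) = n
    · have h := congrFun hx i
      rw [Finsupp.sum, map_sum, Finset.sum_apply, Finset.sum_eq_single n] at h
      · exact h
      · intro m _ hm
        exact toReg_homogeneous (hf m) i fun h => hm (h.symm.trans hi)
      · intro hn
        rw [Finsupp.notMem_support_iff.mp hn, map_zero, Pi.zero_apply]
    · exact toReg_homogeneous (hf n) i hi
  degree := by
    intro n hn x hxJ hx
    match n, hn with
    | 0, _ =>
      rw [degreePart, pow_zero] at hx
      obtain ⟨c, rfl⟩ := Submodule.mem_one.mp hx
      have := congrFun (mem_regKer.mp hxJ) 0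
      rw [toReg_zero_apply, FreeAlgebra.algebraMap_leftInverse c] at this
      simp only [Pi.zero_apply] at this
      rw [this, map_zero]
    | 1, _ =>
      rw [degreePart, pow_one, Finsupp.mem_span_range_iff_exists_finsupp] at hx
      obtain ⟨c, rfl⟩ := hx
      have h := mem_regKer.mp hxJ
      rw [Finsupp.sum, map_sum] at h
      have : c = 0 := by
        ext t
        have ht := congrFun h ⟨index t - 1, by cases t <;> decide⟩
        rw [Finset.sum_apply, Finset.sum_eq_single t] at ht
        · rw [map_smul, toReg_ι, Pi.smul_apply, unitVec, if_pos (by cases t <;> rfl)] at ht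
          simpa using ht
        · intro s _ hs
          rw [map_smul, toReg_ι, Pi.smul_apply, unitVec, if_neg, smul_zero]
          cases s <;> cases t <;> first | exact absurd rfl hs | decide
        · intro hn
          rw [Finsupp.notMem_support_iff.mp hn, zero_smul, map_zero, Pi.zero_apply]
      simp [this]
  coideal := by
    intro x hx
    have hex : Function.Exact ((regKer K).restrictScalars K).subtype (toReg K) := by
      intro y
      simp [mem_regKer]
    -- By right exactness, for surjective `toReg` the kernel of `toReg ⊗ toReg` is exactly the sum
    -- required of a coideal.
    rw [sup_comm, ← TensorProduct.map_ker hex toReg_surjective hex toReg_surjective]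
    exact map_toReg_comul hx

theorem nicholsIdeal_eq_regKer : nicholsIdeal (-1 : K) = regKer K :=
  le_antisymm (fun _ hx => toReg_eq_zero_of_mem hx) isNicholsIdeal_regKer.le

variable (K) in
/-- The Nichols algebra is isomorphic to its regular representation. -/
noncomputable def regEquiv : B4B K ≃ₗ[K] (Fin 72 → K) :=
  LinearEquiv.ofBijective (descend (toReg K) fun _ hv => toReg_eq_zero_of_mem hv) <| by
    constructor
    · rw [injective_iff_map_eq_zero]
      intro v hv
      obtain ⟨x, rfl⟩ := proj_surjective _ v
      rw [descend_proj] at hv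
      rw [proj_eq_zero, nicholsIdeal_eq_regKer]
      exact hv
    · intro m
      obtain ⟨x, rfl⟩ := toReg_surjective m
      exact ⟨proj _ x, rfl⟩

theorem regEquiv_proj (x : FreeAlgebra K Q41) : regEquiv K (proj (-1) x) = toReg K x := rfl

theorem finrank_B4B : Module.finrank K (B4B K) = 72 := by
  rw [(regEquiv K).finrank_eq, Module.finrank_fin_fun]

/-! ### The shifts in coordinates -/

theorem e_mul_self (t : Q41) : e (-1 : K) t * e (-1) t = 0 := by
  rw [e, ← map_mul, proj_eq_zero, nicholsIdeal_eq_regKer, mem_regKer, toReg_ι_mul, toReg_ι,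
    left_unitVec]
  cases t <;> rfl

theorem shift_add_mul (t : Q41) {v w : B4B K} (hv : der (-1) t v = 0) (hw : der (-1) t w = 0) :
    shift K t (v + w * e (-1) t) = w + v * e (-1) t := by
  have hord : orderOf (-1 : K) = 2 := by
    rw [orderOf_neg_one, ringChar.eq_zero, if_neg (by decide)]
  have h := isShift_shift (K := K) t fun j => if j = 0 then v else w
  simp only [hord] at h
  have := h (by intro j _; split_ifs <;> assumption)
  simpa [Finset.sum_range_succ] using this

/-- On `v = a + b e_t` with `a, b ∈ ker ∂_t`, one has `∂_t v = b` and, since `e_t² = 0`, `v e_t = a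
e_t`. -/
theorem shift_apply (t : Q41) (v : B4B K) :
    shift K t v = der (-1) t v + v * e (-1) t := by
  obtain ⟨a, b, ha, hb, rfl⟩ := exists_eq_add_mul t v
  rw [shift_add_mul t ha hb, map_add, ha, der_mul_e t hb, zero_add, add_mul, mul_assoc,
    e_mul_self, mul_zero, add_zero]

theorem shift_sq (t : Q41) : shift K t ^ 2 = 1 := by
  ext v
  obtain ⟨a, b, ha, hb, rfl⟩ := exists_eq_add_mul t v
  rw [sq, LinearEquiv.mul_apply, shift_add_mul t ha hb, shift_add_mul t hb ha,
    LinearEquiv.coe_one, id]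

theorem regEquiv_shift (t : Q41) (v : B4B K) :
    regEquiv K (shift K t v) = (deriv K t + right K t) (regEquiv K v) := by
  obtain ⟨x, rfl⟩ := proj_surjective _ v
  rw [shift_apply, der_proj, e, ← map_mul, map_add, regEquiv_proj, regEquiv_proj, regEquiv_proj,
    toReg_derT, toReg_mul_ι, LinearMap.add_apply]

end Q41

/-! ### Free products generated by two involutions -/

section FreeProduct

variable {G : Type*} [Group G]

/-- The homomorphism from the cyclic group of order two given by an involution. -/
def involutionHom {a : G} (ha : a ^ 2 = 1) : Multiplicative (ZMod 2) →* G where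
  toFun x := a ^ (Multiplicative.toAdd x).val
  map_one' := by simp
  map_mul' x y := by
    rw [toAdd_mul, ZMod.val_add, ← pow_add, ← pow_eq_pow_mod _ ha]

theorem involutionHom_ofAdd_one {a : G} (ha : a ^ 2 = 1) :
    involutionHom ha (Multiplicative.ofAdd 1) = a := by
  simp [involutionHom, ZMod.val_one]

theorem range_involutionHom_le {a : G} (ha : a ^ 2 = 1) {S : Subgroup G} (h : a ∈ S) :
    (involutionHom ha).range ≤ S := by
  rintro _ ⟨x, rfl⟩
  change a ^ (Multiplicative.toAdd x).val ∈ S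
  exact S.pow_mem h _

/-- Conjugation by `a` inverts `a b`: the dihedral relation. -/
theorem mul_zpow_mul_of_sq_eq_one {a b : G} (ha : a ^ 2 = 1) (hb : b ^ 2 = 1) (k : ℤ) :
    a * (a * b) ^ k = (a * b) ^ (-k) * a := by
  have ha' : a⁻¹ = a := inv_eq_of_mul_eq_one_left (by rw [← sq, ha])
  have hb' : b⁻¹ = b := inv_eq_of_mul_eq_one_left (by rw [← sq, hb])
  have h : a * (a * b) * a⁻¹ = (a * b)⁻¹ := by
    rw [mul_inv_rev, hb', ha', ← mul_assoc a a b, ← sq, ha, one_mul]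
  rw [zpow_neg, ← inv_zpow, ← h, conj_zpow, inv_mul_cancel_right]

/-- An element of `C₂ ∗ C₂` is a power of the product of the two generators, possibly times the
first generator. -/
theorem exists_zpow_of_coprod
    (w : Monoid.Coprod (Multiplicative (ZMod 2)) (Multiplicative (ZMod 2))) :
    ∃ k : ℤ,
      w = (.inl (.ofAdd 1) * .inr (.ofAdd 1)) ^ k ∨
      w = (.inl (.ofAdd 1) * .inr (.ofAdd 1)) ^ k * .inl (.ofAdd 1) := by
  have hsq : (Multiplicative.ofAdd (1 : ZMod 2)) ^ 2 = 1 := rfl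
  have cases_two : ∀ m : Multiplicative (ZMod 2), m = 1 ∨ m = .ofAdd 1 := by decide
  generalize hs : (Monoid.Coprod.inl (Multiplicative.ofAdd 1) :
    Monoid.Coprod (Multiplicative (ZMod 2)) (Multiplicative (ZMod 2))) = s
  generalize hu : (Monoid.Coprod.inr (Multiplicative.ofAdd 1) :
    Monoid.Coprod (Multiplicative (ZMod 2)) (Multiplicative (ZMod 2))) = u
  have hs2 : s ^ 2 = 1 := by rw [← hs, ← map_pow, hsq, map_one]
  have hu2 : u ^ 2 = 1 := by rw [← hu, ← map_pow, hsq, map_one]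
  -- Since `u = s (s u)`, multiplying `(s u) ^ k` by `u` equals multiplying `(s u) ^ (k + 1)` by
  -- `s`.
  have us : ∀ k : ℤ, u * (s * u) ^ k = (s * u) ^ (-(k + 1)) * s := by
    intro k
    rw [← mul_zpow_mul_of_sq_eq_one hs2 hu2, add_comm, zpow_one_add, ← mul_assoc, ← mul_assoc,
      ← sq, hs2, one_mul]
  induction w using Monoid.Coprod.induction_on' with
  | one => exact ⟨0, Or.inl (zpow_zero _).symm⟩
  | inl_mul m x hx =>
    rcases cases_two m with rfl | rfl
    · rwa [map_one, one_mul]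
    · rw [hs]
      obtain ⟨k, rfl | rfl⟩ := hx
      · exact ⟨-k, Or.inr (mul_zpow_mul_of_sq_eq_one hs2 hu2 k)⟩
      · refine ⟨-k, Or.inl ?_⟩
        rw [← mul_assoc, mul_zpow_mul_of_sq_eq_one hs2 hu2, mul_assoc, ← sq, hs2, mul_one]
  | inr_mul m x hx =>
    rcases cases_two m with rfl | rfl
    · rwa [map_one, one_mul]
    · rw [hu]
      obtain ⟨k, rfl | rfl⟩ := hx
      · exact ⟨-(k + 1), Or.inr (us k)⟩
      · refine ⟨-(k + 1), Or.inl ?_⟩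
        rw [← mul_assoc, us, mul_assoc, ← sq, hs2, mul_one]

/-- Two involutions whose product has infinite order generate a free product `C₂ ∗ C₂`. -/
theorem nonempty_closure_mulEquiv_coprod {a b : G} (ha : a ^ 2 = 1) (hb : b ^ 2 = 1)
    (hab : ¬ IsOfFinOrder (a * b)) :
    Nonempty ((Subgroup.closure {a, b} : Subgroup G) ≃*
      Monoid.Coprod (Multiplicative (ZMod 2)) (Multiplicative (ZMod 2))) := by
  let F := Monoid.Coprod.lift (involutionHom ha) (involutionHom hb)
  have hFa : F (.inl (.ofAdd 1)) = a := by
    rw [Monoid.Coprod.lift_apply_inl, involutionHom_ofAdd_one]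
  have hFb : F (.inr (.ofAdd 1)) = b := by
    rw [Monoid.Coprod.lift_apply_inr, involutionHom_ofAdd_one]
  have hrange : F.range = Subgroup.closure {a, b} := by
    refine le_antisymm ?_ ((Subgroup.closure_le _).mpr ?_)
    · rw [Monoid.Coprod.range_lift, sup_le_iff]
      exact ⟨range_involutionHom_le ha (Subgroup.subset_closure (Set.mem_insert _ _)),
        range_involutionHom_le hb (Subgroup.subset_closure (Set.mem_insert_of_mem _ rfl))⟩
    · rintro _ (rfl | rfl)
      · exact ⟨_, hFa⟩
      · exact ⟨_, hFb⟩
  have hinj : Function.Injective F := by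
    rw [injective_iff_map_eq_one]
    intro w hw
    obtain ⟨k, rfl | rfl⟩ := exists_zpow_of_coprod w
    · rw [map_zpow, map_mul, hFa, hFb] at hw
      have : k = 0 := by
        by_contra hk
        exact hab (isOfFinOrder_iff_zpow_eq_one.mpr ⟨k, hk, hw⟩)
      rw [this, zpow_zero]
    · rw [map_mul, map_zpow, map_mul, hFa, hFb] at hw
      -- If `(a b)^k a = 1`, then `a` is the inverse of a power of `a b` and commutes with it. Hence
      -- `a b a = b` and `(a b)² = b² = 1`, a contradiction.
      have hcomm : Commute (a * b) a := by
        have h := ((Commute.refl (a * b)).zpow_right k).inv_right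
        rwa [← eq_inv_of_mul_eq_one_right hw] at h
      refine absurd (isOfFinOrder_iff_pow_eq_one.mpr ⟨2, two_pos, ?_⟩) hab
      have h : a * b * a = b := by
        rw [hcomm.eq, ← mul_assoc, ← sq, ha, one_mul]
      rw [sq, ← mul_assoc, h, ← sq, hb]
  exact ⟨((F.ofInjective hinj).trans (MulEquiv.subgroupCongr hrange)).symm⟩

end FreeProduct

/-- A nontrivial unipotent action: `fⁿ x = x + n y`, and `n y ≠ 0` for `n > 0` in characteristic
zero. -/
theorem not_isOfFinOrder_of_apply_eq_add {K V : Type*} [Field K] [CharZero K] [AddCommGroup V]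
    [Module K V] {f : V ≃ₗ[K] V} {x y : V} (hx : f x = x + y) (hy : f y = y) (h0 : y ≠ 0) :
    ¬ IsOfFinOrder f := by
  have h : ∀ n : ℕ, (f ^ n) x = x + (n : K) • y := by
    intro n
    induction n with
    | zero => simp
    | succ n ih =>
      rw [pow_succ', LinearEquiv.mul_apply, ih, map_add, map_smul, hx, hy]
      push_cast
      module
  rw [isOfFinOrder_iff_pow_eq_one]
  rintro ⟨n, hn, hf⟩
  have := h n
  rw [hf, LinearEquiv.coe_one, id, left_eq_add, smul_eq_zero] at this
  rcases this with h | h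
  · exact hn.ne' (by exact_mod_cast h)
  · exact h0 h

/-! ### Jordan form from eight generators and a dimension count -/

section Jordan

open Polynomial

variable {L V : Type*} [Field L] [AddCommGroup V] [Module L V]

theorem prod_X_sub_C_pow {ρ : L} (hρ : IsPrimitiveRoot ρ 3) :
    ∏ i : Fin 3, (X - C (ρ ^ (i : ℕ))) = (X ^ 3 - 1 : L[X]) := by
  have h := hρ.geom_sum_eq_zero (by norm_num)
  replace h := congrArg (C : L →+* L[X]) h
  simp only [Finset.sum_range_succ, Finset.sum_range_zero, map_add, map_pow, map_zero] at h
  simp only [Fin.prod_univ_three, Fin.val_zero, Fin.val_one, Fin.val_two, map_pow]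
  -- The three factors compare the coefficients of `X²`, `X` and `1`, each a multiple of `1 + ρ +
  -- ρ²`.
  linear_combination (-X ^ 2 + X * C ρ - (C ρ - 1)) * h

/-- If `(N³ - 1)³ = 0` and `V` is generated by eight elements as a module over `L[N]`, and has
dimension 72, then the Jordan normal form of `N` has eight blocks of size three for each third root
of unity. -/
theorem exists_basis_jordan {N : Module.End L V} (hN : (N ^ 3 - 1) ^ 3 = 0) {v : Fin 8 → V}
    (hv : ∀ S : Submodule L V, (∀ x ∈ S, N x ∈ S) → (∀ k, v k ∈ S) → S = ⊤)
    (hV : Module.finrank L V = 72) {ρ : L} (hρ : IsPrimitiveRoot ρ 3) :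
    ∃ b : Module.Basis (Fin 3 × (Fin 3 × Fin 8)) L V, LinearMap.toMatrix b b N =
      Matrix.blockDiagonal fun k : Fin 3 × Fin 8 => jordanBlock (ρ ^ (k.1 : ℕ)) := by
  let p (i : Fin 3) : L[X] := X - C (ρ ^ (i : ℕ))
  -- The complementary product projects `v k`, up to a unit, to the generalized eigenspace of `ρ^i`;
  -- `m` counts further applications of `N - ρ^i`.
  let w (m : ℕ) (i : Fin 3) (k : Fin 8) : V := aeval N (p i ^ m * ∏ j ∈ {i}ᶜ, p j ^ 3) (v k)
  have hw3 : ∀ i k, w 3 i k = 0 := by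
    intro i k
    have : p i ^ 3 * ∏ j ∈ {i}ᶜ, p j ^ 3 = (X ^ 3 - 1) ^ 3 := by
      rw [← prod_X_sub_C_pow hρ, ← Finset.prod_pow]
      exact (Fintype.prod_eq_mul_prod_compl i fun j => p j ^ 3).symm
    simp only [w]
    rw [this]
    simp [hN]
  have hNw : ∀ m i k, N (w m i k) = ρ ^ (i : ℕ) • w m i k + w (m + 1) i k := by
    intro m i k
    simp only [w]
    rw [pow_succ' (p i), mul_assoc, map_mul (aeval N) (p i), Module.End.mul_apply]
    simp only [p, map_sub, aeval_X, aeval_C, LinearMap.sub_apply, Module.algebraMap_end_apply]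
    abel
  -- The chain is reversed: with ones above the diagonal, the first basis vector of a block is the
  -- eigenvector `w 2`.
  let f : Fin 3 × (Fin 3 × Fin 8) → V := fun x => w (2 - x.1) x.2.1 x.2.2
  have hwf : ∀ m i k, w m i k ∈ Submodule.span L (Set.range f) ∨ 3 < m := by
    intro m i k
    by_cases hm : m < 3
    · refine Or.inl (Submodule.subset_span ⟨(⟨2 - m, by omega⟩, i, k), ?_⟩)
      simp only [f]
      congr 1
      omega
    · rcases (by omega : m = 3 ∨ 3 < m) with rfl | h
      · rw [hw3]
        exact Or.inl (Submodule.zero_mem _)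
      · exact Or.inr h
  have hstable : ∀ x ∈ Submodule.span L (Set.range f), N x ∈ Submodule.span L (Set.range f) := by
    intro x hx
    induction hx using Submodule.span_induction with
    | mem x hx =>
      obtain ⟨⟨m, i, k⟩, rfl⟩ := hx
      simp only [f, hNw]
      refine Submodule.add_mem _ (Submodule.smul_mem _ _ ?_) ?_
      · exact (hwf _ i k).resolve_right (by omega)
      · exact (hwf _ i k).resolve_right (by omega)
    | zero => rw [map_zero]; exact Submodule.zero_mem _
    | add x y _ _ hx hy => rw [map_add]; exact Submodule.add_mem _ hx hy
    | smul c x _ hx => rw [map_smul]; exact Submodule.smul_mem _ _ hx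
  have haeval : ∀ (q : L[X]), ∀ x ∈ Submodule.span L (Set.range f),
      aeval N q x ∈ Submodule.span L (Set.range f) := by
    intro q x hx
    induction q using Polynomial.induction_on' with
    | add q r hq hr => rw [map_add]; exact Submodule.add_mem _ hq hr
    | monomial n c =>
      rw [aeval_monomial, Module.End.mul_apply, Module.algebraMap_end_apply]
      refine Submodule.smul_mem _ _ ?_
      induction n with
      | zero => exact hx
      | succ n ih => rw [pow_succ', Module.End.mul_apply]; exact hstable _ ih
  have hcop : Pairwise (Function.onFun IsCoprime fun i => p i ^ 3) := by
    intro i j hij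
    refine IsCoprime.pow (isCoprime_X_sub_C_of_isUnit_sub (sub_ne_zero.mpr fun h => hij ?_).isUnit)
    exact Fin.ext (hρ.pow_inj i.2 j.2 h)
  -- Bézout: the complementary products generate the unit ideal, so each `v k` is recovered from the
  -- vectors `w 0 i k`.
  obtain ⟨μ, hμ⟩ := exists_sum_eq_one_iff_pairwise_coprime'.mpr hcop
  have hspan : Submodule.span L (Set.range f) = ⊤ := by
    refine hv _ hstable fun k => ?_
    have : v k = ∑ i, aeval N (μ i) (w 0 i k) := by
      simp only [w, pow_zero, one_mul, ← Module.End.mul_apply, ← map_mul, ← LinearMap.sum_apply,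
        ← map_sum, hμ]
      simp
    rw [this]
    exact Submodule.sum_mem _ fun i _ => haeval _ _ ((hwf 0 i k).resolve_right (by omega))
  -- There are `3 · 3 · 8 = 72` spanning vectors, so the dimension forces independence.
  let b := basisOfTopLeSpanOfCardEqFinrank f hspan.ge (by rw [hV]; rfl)
  have hb : ∀ x, b x = f x := fun x => by simp [b]
  refine ⟨b, ?_⟩
  ext ⟨m, k⟩ ⟨m', k'⟩
  have hcol : N (b (m', k')) = ∑ l : Fin 3, jordanBlock (ρ ^ (k'.1 : ℕ)) l m' • b (l, k') := by
    simp only [hb, f, hNw, Fin.sum_univ_three]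
    fin_cases m' <;> simp [jordanBlock, hw3, add_comm]
  rw [LinearMap.toMatrix_apply, hcol, Matrix.blockDiagonal_apply]
  simp only [map_sum, map_smul, Module.Basis.repr_self, Finsupp.coe_finsetSum, Finset.sum_apply,
    Finsupp.coe_smul, Pi.smul_apply, Finsupp.single_apply, Prod.mk.injEq, smul_eq_mul]
  split_ifs with h
  · subst h
    simp
  · simp [Ne.symm h]

end Jordan

/-- The hypotheses survive extension of scalars. For generation, an `N`-stable `L`-subspace is
pulled back along `x ↦ 1 ⊗ x` to an `N`-stable `K`-subspace. -/
theorem exists_basis_jordan_baseChange {K L V : Type*} [Field K] [Field L] [Algebra K L]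
    [AddCommGroup V] [Module K V] {N : Module.End K V} (hN : (N ^ 3 - 1) ^ 3 = 0) {v : Fin 8 → V}
    (hv : ∀ S : Submodule K V, (∀ x ∈ S, N x ∈ S) → (∀ k, v k ∈ S) → S = ⊤)
    (hV : Module.finrank K V = 72) {ρ : L} (hρ : IsPrimitiveRoot ρ 3) :
    ∃ b : Module.Basis (Fin 3 × (Fin 3 × Fin 8)) L (L ⊗[K] V),
      LinearMap.toMatrix b b (N.baseChange L) =
      Matrix.blockDiagonal fun k : Fin 3 × Fin 8 => jordanBlock (ρ ^ (k.1 : ℕ)) := by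
  refine exists_basis_jordan (v := fun k => 1 ⊗ₜ v k) ?_ (fun S hS hvS => ?_) ?_ hρ
  · have := congrArg (Module.End.baseChangeHom K L V) hN
    rw [map_pow, map_sub, map_pow, map_one, map_zero] at this
    exact this
  · have h := hv ((S.restrictScalars K).comap (TensorProduct.mk K L V 1))
      (fun x hx => hS _ hx) hvS
    rw [eq_top_iff]
    intro z _
    induction z with
    | zero => exact S.zero_mem
    | add x y hx hy => exact S.add_mem (hx trivial) (hy trivial)
    | tmul a x =>
      have hx : (1 : L) ⊗ₜ[K] x ∈ S := (h ▸ Submodule.mem_top :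
        x ∈ (S.restrictScalars K).comap (TensorProduct.mk K L V 1))
      simpa [TensorProduct.smul_tmul'] using S.smul_mem a hx
  · rw [Module.finrank_baseChange, hV]

/-! ### The product `φ₁ φ₂` -/

namespace Q41

variable {K : Type*} [Field K]

variable (K) in
/-- The product `φ₁ φ₂` in the regular representation. -/
noncomputable def regProd : Module.End K (Fin 72 → K) :=
  (deriv K x1 + right K x1) * (deriv K x2 + right K x2)

theorem shift_eval (t : Q41) (v : SVec) :
    (deriv K t + right K t) (v.eval K 72) = (applyShift t v).eval K 72 := by
  rw [LinearMap.add_apply, deriv_eval, right_eval, applyShift, SVec.eval_addScaled, Int.cast_one,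
    one_smul]

theorem regProd_eval (v : SVec) : regProd K (v.eval K 72) = (applyProd v).eval K 72 := by
  rw [regProd, Module.End.mul_apply, shift_eval, shift_eval, applyProd]

theorem cubeSub_eval (v : SVec) :
    (regProd K ^ 3 - 1 : Module.End K (Fin 72 → K)) (v.eval K 72) = (applyCubeSub v).eval K 72 := by
  rw [applyCubeSub, SVec.eval_addScaled, ← regProd_eval, ← regProd_eval, ← regProd_eval,
    Int.cast_neg, Int.cast_one, neg_one_smul, neg_add_eq_sub]
  rfl

theorem cubeSub_pow_three : (regProd K ^ 3 - 1) ^ 3 = 0 := by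
  refine linearMap_ext fun i hi => ?_
  rw [pow_succ, pow_two, Module.End.mul_apply, Module.End.mul_apply, ← SVec.eval_singleton,
    cubeSub_eval, cubeSub_eval, cubeSub_eval, cubeSub_check i hi]
  rfl

/-- The 72 orbit vectors are monic polynomials in `φ₁ φ₂` of degrees `0, …, 8` applied to the eight
generators, so they stay in `S`; by computation they span. -/
theorem eq_top_of_regProd_mem {S : Submodule K (Fin 72 → K)} (hS : ∀ x ∈ S, regProd K x ∈ S)
    (h : ∀ k, unitVec K 72 (generatorIndex k) ∈ S) : S = ⊤ := by
  have hP : ∀ v : SVec, v.eval K 72 ∈ S → (applyProd v).eval K 72 ∈ S := by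
    intro v hv
    rw [← regProd_eval]
    exact hS _ hv
  have hU : ∀ v : SVec, v.eval K 72 ∈ S → (applyCubeSub v).eval K 72 ∈ S := by
    intro v hv
    rw [← cubeSub_eval]
    exact S.sub_mem (hS _ (hS _ (hS _ hv))) hv
  refine SVec.eq_top_of_reduce (vs := orbitVectors) (fun v hv => ?_) orbitVectors_check
  rw [orbitVectors, List.mem_flatMap] at hv
  obtain ⟨i, hi, hv⟩ := hv
  obtain ⟨u, hu, hv⟩ := List.mem_flatMap.mp hv
  have hiS : SVec.eval K 72 [(i, 1)] ∈ S := by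
    rw [SVec.eval_singleton]
    obtain ⟨k, hk, rfl⟩ := List.mem_iff_getElem.mp hi
    have := h ⟨k, hk⟩
    rwa [generatorIndex, List.getD_eq_getElem _ _ hk] at this
  have huS : u.eval K 72 ∈ S := by
    simp only [List.mem_cons, List.not_mem_nil, or_false] at hu
    rcases hu with rfl | rfl | rfl
    · exact hiS
    · exact hU _ hiS
    · exact hU _ (hU _ hiS)
  simp only [List.mem_cons, List.not_mem_nil, or_false] at hv
  rcases hv with rfl | rfl | rfl
  · exact huS
  · exact hP _ huS
  · exact hP _ (hP _ huS)

variable [CharZero K]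

variable (K) in
/-- The endomorphism `φ₁ φ₂` of the Nichols algebra. -/
noncomputable def shiftProd : Module.End K (B4B K) := (shift K x1 * shift K x2).toLinearMap

theorem regEquiv_shiftProd (v : B4B K) :
    regEquiv K (shiftProd K v) = regProd K (regEquiv K v) := by
  rw [shiftProd, LinearEquiv.coe_toLinearMap, LinearEquiv.mul_apply, regEquiv_shift,
    regEquiv_shift, regProd, Module.End.mul_apply]

theorem conj_shiftProd : (regEquiv K).conjAlgEquiv K (shiftProd K) = regProd K := by
  ext1 i
  ext1
  simp [LinearEquiv.conjAlgEquiv_apply, regEquiv_shiftProd]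

theorem shiftProd_cube_sub_pow : (shiftProd K ^ 3 - 1) ^ 3 = 0 := by
  refine ((regEquiv K).conjAlgEquiv K).injective ?_
  rw [map_pow, map_sub, map_pow, map_one, map_zero, conj_shiftProd, cubeSub_pow_three]

theorem eq_top_of_shiftProd_mem {S : Submodule K (B4B K)} (hS : ∀ x ∈ S, shiftProd K x ∈ S)
    (h : ∀ k, (regEquiv K).symm (unitVec K 72 (generatorIndex k)) ∈ S) : S = ⊤ := by
  have := eq_top_of_regProd_mem (S := S.comap (regEquiv K).symm.toLinearMap) (fun x hx => ?_) h
  · rw [eq_top_iff]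
    intro v _
    have hv : regEquiv K v ∈ S.comap (regEquiv K).symm.toLinearMap := this ▸ Submodule.mem_top
    simpa using hv
  · have := hS _ hx
    rw [Submodule.mem_comap]
    convert this
    refine (regEquiv K).injective ?_
    rw [regEquiv_shiftProd]
    simp

theorem not_isOfFinOrder_shift_mul_shift : ¬ IsOfFinOrder (shift K x1 * shift K x2) := by
  let g := (regEquiv K).symm
  have hpow : ∀ m, ((shift K x1 * shift K x2) ^ 3) (g m) =
      g ((regProd K ^ 3 - 1 : Module.End K (Fin 72 → K)) m + m) := by
    intro m
    refine (regEquiv K).injective ?_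
    have : ((shift K x1 * shift K x2) ^ 3) (g m) =
      shiftProd K (shiftProd K (shiftProd K (g m))) := rfl
    rw [this, regEquiv_shiftProd, regEquiv_shiftProd, regEquiv_shiftProd]
    simp [g, pow_succ]
  intro h
  -- The cube is used because it is unipotent: it fixes `b₂₄` and moves `b₃₇` by `-b₂₄`.
  refine not_isOfFinOrder_of_apply_eq_add (x := g (SVec.eval K 72 [(37, 1)]))
    (y := g (SVec.eval K 72 [(24, -1)])) ?_ ?_ ?_ (h.pow (n := 3))
  · rw [hpow, cubeSub_eval, cubeSub_ne_check.1, map_add, add_comm]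
  · rw [hpow, cubeSub_eval, cubeSub_ne_check.2, SVec.eval_nil, zero_add]
  · rw [Ne, LinearEquiv.map_eq_zero_iff]
    intro h
    -- Coordinate `23` in `Fin 72` is the one of `b₂₄`.
    have := congrFun h 23
    rw [SVec.eval_apply] at this
    simp [SVec.coord] at this

end Q41

end RackNichols

/-! ### The main theorem -/

theorem mainTheorem8 (K : Type*) [Field K] [CharZero K] :
    -- the algebra has dimension 72
    Module.finrank K (RackNichols.B4B K) = 72 ∧
    -- the shift group is infinite
    Infinite (RackNichols.shiftGroup K) ∧
    -- over every extension field with primitive third roots of unity `ρ` and `ρ ^ 2`, the Jordan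
    -- normal form of `φ₁ φ₂` has eight blocks of size three for each of `1`, `ρ`, `ρ ^ 2`
    (∀ (L : Type*) [Field L] [Algebra K L] (ρ : L), IsPrimitiveRoot ρ 3 →
      ∃ b : Module.Basis (Fin 3 × (Fin 3 × Fin 8)) L (TensorProduct K L (RackNichols.B4B K)),
        LinearMap.toMatrix b b (LinearMap.baseChange L
          (RackNichols.shift K .x1 * RackNichols.shift K .x2).toLinearMap) =
        Matrix.blockDiagonal fun k : Fin 3 × Fin 8 =>
          RackNichols.jordanBlock (ρ ^ (k.1 : ℕ))) ∧
    -- in particular it has infinite order, and `φ₁`, `φ₂` generate a free product `C₂ ∗ C₂`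
    ¬ IsOfFinOrder (RackNichols.shift K .x1 * RackNichols.shift K .x2) ∧
    Nonempty
      ((Subgroup.closure {RackNichols.shift K .x1, RackNichols.shift K .x2} :
          Subgroup (RackNichols.B4B K ≃ₗ[K] RackNichols.B4B K)) ≃*
        Monoid.Coprod (Multiplicative (ZMod 2)) (Multiplicative (ZMod 2))) := by
  open RackNichols RackNichols.Q41 in
  refine ⟨finrank_B4B, ?_, fun L _ _ ρ hρ => ?_, not_isOfFinOrder_shift_mul_shift,
    nonempty_closure_mulEquiv_coprod (shift_sq _) (shift_sq _) not_isOfFinOrder_shift_mul_shift⟩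
  · by_contra h
    rw [not_infinite_iff_finite] at h
    have hmem : ∀ t, shift K t ∈ shiftGroup K := fun t => Subgroup.subset_closure ⟨t, rfl⟩
    have := isOfFinOrder_of_finite
      (⟨_, (shiftGroup K).mul_mem (hmem x1) (hmem x2)⟩ : shiftGroup K)
    exact not_isOfFinOrder_shift_mul_shift (Submonoid.isOfFinOrder_coe.mpr this)
  · exact exists_basis_jordan_baseChange (N := shiftProd K) shiftProd_cube_sub_pow
      (fun S hS h => eq_top_of_shiftProd_mem hS h) finrank_B4B hρ
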